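/- **Setting.** Let $c_0>0$, let $D\subset\mathbb{R}^3$ be a bounded open set, and let $q_c\in L^\infty(D)$ be real valued with $0\le q_c(x)\le q_{c,+}$ for almost every $x\in D$, where $q_{c,+}\ge 0$ is a constant. Let $L^2_{q_c}(D)$ be the complex Hilbert space $L^2(D;\,q_c\,dx)$ with norm $\|u\|_{L^2_{q_c}(D)}^2=\int_D q_c|u|^2\,dx$. For $s\in\mathbb{C}$ define $$(\hat V f)(x)=\int_D \frac{e^{-s|x-y|/c_0}}{4\pi|x-y|}\,f(y)\,dy,\qquad \hat V_{q_c}g=\hat V(q_c g).$$ Here $\hat V_{q_c}$ is a bounded operator from $L^2_{q_c}(D)$ to $L^2(D)$ and, using the embedding $L^2(D)\to L^2_{q_c}(D)$, is regarded as a bounded operator on $L^2_{q_c}(D)$. **Theorem.** For every $s\in\mathbb{C}$ with $\operatorname{Re}s=\sigma>0$ the operator $I+\frac{s^2}{c_0^2}\hat V_{q_c}$ has a bounded inverse on $L^2_{q_c}(D)$, and in the operator norm of $L^2_{q_c}(D)$ $$\Big\|\Big(I+\tfrac{s^2}{c_0^2}\hat V_{q_c}\Big)^{-1}\tfrac{s^2}{c_0^2}\hat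 V_{q_c}\Big\|\le \frac{q_{c,+}}{\sigma^2}\,|s|^2,\qquad \Big\|\Big(I+\tfrac{s^2}{c_0^2}\hat V_{q_c}\Big)^{-1}\Big\|\le\frac{|s|}{\sigma}.$$ Moreover, the operator-valued functions $s\mapsto \big(I+\frac{s^2}{c_0^2}\hat V_{q_c}\big)^{-1}\frac{s^2}{c_0^2}\hat V_{q_c}$ and $s\mapsto \big(I+\frac{s^2}{c_0^2}\hat V_{q_c}\big)^{-1}$ are analytic in the half plane $\{\operatorname{Re}s>0\}$ with respect to the operator norm. -/

import Mathlib

open MeasureTheory Filter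
open scoped ENNReal Ring

noncomputable section

/-- Three-dimensional Euclidean space. -/
abbrev E3 : Type := EuclideanSpace ℝ (Fin 3)

/-- The kernel `Φ(x,y) = exp(-s|x-y|/c₀) / (4π|x-y|)` (its value on the diagonal plays no role). -/
def helmholtzKernel (c₀ : ℝ) (s : ℂ) (x y : E3) : ℂ :=
  Complex.exp (-s * (‖x - y‖ : ℂ) / (c₀ : ℂ)) / (4 * (Real.pi : ℂ) * (‖x - y‖ : ℂ))

/-- The volume potential `(V̂ f)(x) = ∫_D Φ(x,y) f(y) dy`. -/
def volumePotential (D : Set E3) (c₀ : ℝ) (s : ℂ) (f : E3 → ℂ) (x : E3) : ℂ :=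
  ∫ y in D, helmholtzKernel c₀ s x y * f y

/-- The complex Hilbert space `L²(D)`. -/
abbrev L2 (D : Set E3) : Type := Lp ℂ 2 (volume.restrict D)

/-- The measure `q dx` on `D`. -/
def weightedMeasure (D : Set E3) (q : E3 → ℝ) : Measure E3 :=
  (volume.restrict D).withDensity fun x => ENNReal.ofReal (q x)

/-- The weighted space `L²_q(D)`, with norm `‖u‖² = ∫_D q |u|² dx`. -/
abbrev L2w (D : Set E3) (q : E3 → ℝ) : Type := Lp ℂ 2 (weightedMeasure D q)

/-- `q` belongs to `L^∞(D)` and is nonnegative almost everywhere in `D`. -/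
structure IsContrast (D : Set E3) (q : E3 → ℝ) : Prop where
  memLp : MemLp q ∞ (volume.restrict D)
  nonneg : ∀ᵐ x ∂volume.restrict D, 0 ≤ q x

theorem eLpNorm_le_of_sq {μ ν : Measure E3} {f g : E3 → ℂ} {C : ℝ} (hC : 0 ≤ C)
    (h : ∫⁻ x, ‖g x‖ₑ ^ 2 ∂ν ≤ ENNReal.ofReal (C ^ 2) * ∫⁻ x, ‖f x‖ₑ ^ 2 ∂μ) :
    eLpNorm g 2 ν ≤ ENNReal.ofReal C * eLpNorm f 2 μ := by
  rw [eLpNorm_eq_lintegral_rpow_enorm_toReal two_ne_zero ENNReal.ofNat_ne_top,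
    eLpNorm_eq_lintegral_rpow_enorm_toReal two_ne_zero ENNReal.ofNat_ne_top]
  have h2 : ENNReal.ofReal C = ENNReal.ofReal (C ^ 2) ^ (1 / (2 : ℝ)) := by
    rw [ENNReal.ofReal_rpow_of_nonneg (by positivity) (by positivity), ← Real.sqrt_eq_rpow,
      Real.sqrt_sq hC]
  rw [ENNReal.toReal_ofNat, h2, ← ENNReal.mul_rpow_of_nonneg _ _ (by positivity)]
  refine ENNReal.rpow_le_rpow ?_ (by positivity)
  simpa using h

theorem memLp_of_bound {μ ν : Measure E3} {T : (E3 → ℂ) → E3 → ℂ}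
    (hmem : ∀ f : Lp ℂ 2 μ, AEStronglyMeasurable (T f) ν)
    (hbd : ∃ C : ℝ, 0 ≤ C ∧ ∀ f : Lp ℂ 2 μ, ∫⁻ x, ‖T f x‖ₑ ^ 2 ∂ν ≤
      ENNReal.ofReal (C ^ 2) * ∫⁻ x, ‖f x‖ₑ ^ 2 ∂μ) (f : Lp ℂ 2 μ) : MemLp (T f) 2 ν := by
  obtain ⟨C, hC, h⟩ := hbd
  exact ⟨hmem f, (eLpNorm_le_of_sq hC (h f)).trans_lt
    (ENNReal.mul_lt_top ENNReal.ofReal_lt_top (Lp.memLp f).eLpNorm_lt_top)⟩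

/-- The bounded operator between `L²` spaces induced by a map `T` on functions. -/
def lpOperator {μ ν : Measure E3} (T : (E3 → ℂ) → E3 → ℂ)
    (hadd : ∀ f g : Lp ℂ 2 μ, T ⇑(f + g) =ᵐ[ν] T f + T g)
    (hsmul : ∀ (c : ℂ) (f : Lp ℂ 2 μ), T ⇑(c • f) =ᵐ[ν] c • T f)
    (hmem : ∀ f : Lp ℂ 2 μ, AEStronglyMeasurable (T f) ν)
    (hbd : ∃ C : ℝ, 0 ≤ C ∧ ∀ f : Lp ℂ 2 μ, ∫⁻ x, ‖T f x‖ₑ ^ 2 ∂ν ≤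
      ENNReal.ofReal (C ^ 2) * ∫⁻ x, ‖f x‖ₑ ^ 2 ∂μ) :
    Lp ℂ 2 μ →L[ℂ] Lp ℂ 2 ν :=
  LinearMap.mkContinuousOfExistsBound
    { toFun := fun f => (memLp_of_bound hmem hbd f).toLp (T f)
      map_add' := fun f g => by
        rw [← MemLp.toLp_add (memLp_of_bound hmem hbd f) (memLp_of_bound hmem hbd g)]
        exact MemLp.toLp_congr _ _ (hadd f g)
      map_smul' := fun c f => by
        rw [RingHom.id_apply, ← MemLp.toLp_const_smul c (memLp_of_bound hmem hbd f)]
        exact MemLp.toLp_congr _ _ (hsmul c f) }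
    (by
      obtain ⟨C, hC, h⟩ := id hbd
      refine ⟨C, fun f => ?_⟩
      change ‖(memLp_of_bound hmem hbd f).toLp (T f)‖ ≤ C * ‖f‖
      rw [Lp.norm_toLp, Lp.norm_def, ← ENNReal.toReal_ofReal hC, ← ENNReal.toReal_mul]
      simpa only [ENNReal.toReal_ofReal hC] using
        ENNReal.toReal_mono (ENNReal.mul_ne_top ENNReal.ofReal_ne_top
          (Lp.memLp f).eLpNorm_lt_top.ne) (eLpNorm_le_of_sq hC (h f)))

theorem lpOperator_coeFn {μ ν : Measure E3} (T : (E3 → ℂ) → E3 → ℂ) (hadd hsmul hmem hbd)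
    (f : Lp ℂ 2 μ) : lpOperator (μ := μ) (ν := ν) T hadd hsmul hmem hbd f =ᵐ[ν] T f :=
  MemLp.coeFn_toLp (memLp_of_bound hmem hbd f)

theorem measurable_helmholtzKernel (c₀ : ℝ) (s : ℂ) :
    Measurable fun p : E3 × E3 => helmholtzKernel c₀ s p.1 p.2 := by
  unfold helmholtzKernel
  fun_prop

theorem helmholtzKernel_comm (c₀ : ℝ) (s : ℂ) (x y : E3) :
    helmholtzKernel c₀ s x y = helmholtzKernel c₀ s y x := by
  simp only [helmholtzKernel, norm_sub_rev x y]

theorem helmholtzKernel_bound {D : Set E3} (hD : Bornology.IsBounded D) (c₀ : ℝ) (s : ℂ) :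
    ∃ C : ℝ, 0 ≤ C ∧ ∀ x ∈ D,
      ∫⁻ y in D, ‖helmholtzKernel c₀ s x y‖ₑ ≤ ENNReal.ofReal C := by
  obtain ⟨R, hR⟩ := hD.subset_ball 0
  have hdist : ∀ x ∈ D, ∀ y ∈ D, y - x ∈ Metric.ball (0 : E3) (2 * R) := fun x hx y hy => by
    have h1 := hR hx
    have h2 := hR hy
    simp only [mem_ball_zero_iff] at *
    linarith [norm_sub_le y x]
  have hint : IntegrableOn (fun z : E3 => helmholtzKernel c₀ s 0 z)
      (Metric.ball 0 (2 * R)) volume := by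
    refine integrableOn_ball_of_norm_le_rpow (α := 1) (C := Real.exp (‖s‖ * (2 * R) / |c₀|))
      (by simp) (by simp) ?_ ?_
    · refine (ae_restrict_iff' Metric.isOpen_ball.measurableSet).2 (.of_forall fun z hz => ?_)
      rw [mem_ball_zero_iff] at hz
      have e1 : ‖Complex.exp (-s * (‖z‖ : ℂ) / (c₀ : ℂ))‖ ≤ Real.exp (‖s‖ * (2 * R) / |c₀|) := by
        refine (Complex.norm_exp_le_exp_norm _).trans (Real.exp_le_exp.2 ?_)
        rw [norm_div, norm_mul, norm_neg, Complex.norm_real, Complex.norm_real, norm_norm,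
          Real.norm_eq_abs]
        gcongr
      have e2 : ‖(4 * (Real.pi : ℂ) * (‖z‖ : ℂ))‖ = 4 * Real.pi * ‖z‖ := by
        simp [abs_of_pos Real.pi_pos]
      rw [helmholtzKernel, zero_sub, norm_neg, norm_div, e2, Real.rpow_neg_one, div_eq_mul_inv]
      refine mul_le_mul e1 ?_ (by positivity) (by positivity)
      rw [mul_inv]
      refine mul_le_of_le_one_left (by positivity) (inv_le_one_of_one_le₀ ?_)
      linarith [Real.pi_gt_three]
    · exact ((measurable_helmholtzKernel c₀ s).comp
        (measurable_const.prodMk measurable_id)).aestronglyMeasurable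
  refine ⟨(∫⁻ z in Metric.ball (0 : E3) (2 * R), ‖helmholtzKernel c₀ s 0 z‖ₑ).toReal,
    ENNReal.toReal_nonneg, fun x hx => ?_⟩
  rw [ENNReal.ofReal_toReal hint.2.ne]
  have hshift : ∀ y, helmholtzKernel c₀ s x y = helmholtzKernel c₀ s 0 (y - x) := fun y => by
    simp [helmholtzKernel, norm_sub_rev x y]
  calc ∫⁻ y in D, ‖helmholtzKernel c₀ s x y‖ₑ
      ≤ ∫⁻ y in (fun y => y - x) ⁻¹' Metric.ball (0 : E3) (2 * R),
          ‖helmholtzKernel c₀ s 0 (y - x)‖ₑ := by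
        simp_rw [hshift]
        exact lintegral_mono_set fun y hy => hdist x hx y hy
    _ = ∫⁻ z in Metric.ball (0 : E3) (2 * R), ‖helmholtzKernel c₀ s 0 z‖ₑ :=
        (measurePreserving_sub_right volume x).setLIntegral_comp_preimage
          Metric.isOpen_ball.measurableSet
          ((measurable_helmholtzKernel c₀ s).comp
            (measurable_const.prodMk measurable_id)).enorm

/-- Schur's test for the kernel on `D`. -/
theorem schur_bound {D : Set E3} (hDm : MeasurableSet D) (hD : Bornology.IsBounded D) (c₀ : ℝ)
    (s : ℂ) : ∃ C : ℝ, 0 ≤ C ∧ ∀ f : L2 D,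
      ∫⁻ x in D, (∫⁻ y in D, ‖helmholtzKernel c₀ s x y * f y‖ₑ) ^ 2 ≤
        ENNReal.ofReal (C ^ 2) * ∫⁻ x in D, ‖f x‖ₑ ^ 2 := by
  obtain ⟨C, hC, hb⟩ := helmholtzKernel_bound hD c₀ s
  refine ⟨C, hC, fun f => ?_⟩
  have hk := measurable_helmholtzKernel c₀ s
  have hfm : Measurable fun y => ‖f y‖ₑ := (Lp.stronglyMeasurable f).measurable.enorm
  have hkx : ∀ x, Measurable fun y => ‖helmholtzKernel c₀ s x y‖ₑ := fun x =>
    (hk.comp (measurable_const.prodMk measurable_id)).enorm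
  have h1 : ∀ x ∈ D, (∫⁻ y in D, ‖helmholtzKernel c₀ s x y * f y‖ₑ) ^ 2 ≤
      ENNReal.ofReal C * ∫⁻ y in D, ‖helmholtzKernel c₀ s x y‖ₑ * ‖f y‖ₑ ^ 2 := fun x hx => by
    have hH := ENNReal.lintegral_mul_norm_pow_le (μ := volume.restrict D)
      (f := fun y => ‖helmholtzKernel c₀ s x y‖ₑ)
      (g := fun y => ‖helmholtzKernel c₀ s x y‖ₑ * ‖f y‖ₑ ^ 2)
      (hkx x).aemeasurable ((hkx x).mul (hfm.pow_const 2)).aemeasurable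
      (p := 1 / 2) (q := 1 / 2) (by norm_num) (by norm_num) (by norm_num)
    have hsq : ∀ a b : ℝ≥0∞, a ^ (1 / 2 : ℝ) * (a * b ^ 2) ^ (1 / 2 : ℝ) = a * b := fun a b => by
      rw [ENNReal.mul_rpow_of_nonneg _ _ (by norm_num), ← mul_assoc,
        ← ENNReal.rpow_add_of_nonneg _ _ (by norm_num) (by norm_num), ← ENNReal.rpow_natCast,
        ← ENNReal.rpow_mul]
      norm_num
    simp only [hsq] at hH
    simp only [enorm_mul]
    calc _ ≤ _ := pow_le_pow_left₀ zero_le hH 2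
      _ = (∫⁻ y in D, ‖helmholtzKernel c₀ s x y‖ₑ) *
          ∫⁻ y in D, ‖helmholtzKernel c₀ s x y‖ₑ * ‖f y‖ₑ ^ 2 := by
        rw [mul_pow, ← ENNReal.rpow_natCast, ← ENNReal.rpow_natCast, ← ENNReal.rpow_mul,
          ← ENNReal.rpow_mul]
        norm_num
      _ ≤ _ := by gcongr; exact hb x hx
  calc ∫⁻ x in D, (∫⁻ y in D, ‖helmholtzKernel c₀ s x y * f y‖ₑ) ^ 2
      ≤ ∫⁻ x in D, ENNReal.ofReal C *
          ∫⁻ y in D, ‖helmholtzKernel c₀ s x y‖ₑ * ‖f y‖ₑ ^ 2 :=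
        setLIntegral_mono' hDm h1
    _ = ENNReal.ofReal C * ∫⁻ x in D, ∫⁻ y in D, ‖helmholtzKernel c₀ s x y‖ₑ * ‖f y‖ₑ ^ 2 :=
        lintegral_const_mul' _ _ ENNReal.ofReal_ne_top
    _ = ENNReal.ofReal C * ∫⁻ y in D, ∫⁻ x in D, ‖helmholtzKernel c₀ s x y‖ₑ * ‖f y‖ₑ ^ 2 := by
        rw [lintegral_lintegral_swap]
        exact (hk.enorm.mul ((hfm.comp measurable_snd).pow_const 2)).aemeasurable
    _ ≤ ENNReal.ofReal C * ∫⁻ y in D, ENNReal.ofReal C * ‖f y‖ₑ ^ 2 := by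
        refine mul_le_mul_right ?_ _
        refine setLIntegral_mono' hDm fun y hy => ?_
        simp_rw [helmholtzKernel_comm c₀ s _ y]
        rw [lintegral_mul_const _ (hkx y)]
        gcongr
        exact hb y hy
    _ = ENNReal.ofReal (C ^ 2) * ∫⁻ x in D, ‖f x‖ₑ ^ 2 := by
        rw [lintegral_const_mul' _ _ ENNReal.ofReal_ne_top, ← mul_assoc, sq,
          ENNReal.ofReal_mul hC]

theorem integrable_kernel_mul {D : Set E3} (hDm : MeasurableSet D) (hD : Bornology.IsBounded D)
    (c₀ : ℝ) (s : ℂ) (f : L2 D) : ∀ᵐ x ∂volume.restrict D,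
      Integrable (fun y => helmholtzKernel c₀ s x y * f y) (volume.restrict D) := by
  obtain ⟨C, -, h⟩ := schur_bound hDm hD c₀ s
  have hk := measurable_helmholtzKernel c₀ s
  have hf : Measurable f := (Lp.stronglyMeasurable f).measurable
  have hfin : ∫⁻ x in D, ‖f x‖ₑ ^ 2 ≠ ∞ := by
    have := lintegral_rpow_enorm_lt_top_of_eLpNorm_lt_top two_ne_zero ENNReal.ofNat_ne_top
      (Lp.memLp f).eLpNorm_lt_top
    simpa using this.ne
  have hm : Measurable fun x => (∫⁻ y in D, ‖helmholtzKernel c₀ s x y * f y‖ₑ) ^ 2 :=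
    (Measurable.lintegral_prod_right' (f := fun p : E3 × E3 =>
      ‖helmholtzKernel c₀ s p.1 p.2 * f p.2‖ₑ)
      (hk.mul (hf.comp measurable_snd)).enorm).pow_const 2
  filter_upwards [ae_lt_top hm ((h f).trans_lt
    (ENNReal.mul_lt_top ENNReal.ofReal_lt_top hfin.lt_top)).ne] with x hx
  refine ⟨((hk.comp (measurable_const.prodMk measurable_id)).mul hf).aestronglyMeasurable, ?_⟩
  exact lt_top_iff_ne_top.2 fun h0 => by
    rw [h0] at hx
    simp at hx

/-- The volume potential as a bounded operator `V̂ : L²(D) → L²(D)`. -/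
def potentialOp {D : Set E3} (hDo : IsOpen D) (hDb : Bornology.IsBounded D) (c₀ : ℝ) (s : ℂ) :
    L2 D →L[ℂ] L2 D :=
  lpOperator (volumePotential D c₀ s)
    (fun f g => by
      filter_upwards [integrable_kernel_mul hDo.measurableSet hDb c₀ s f,
        integrable_kernel_mul hDo.measurableSet hDb c₀ s g] with x hf hg
      simp only [volumePotential, Pi.add_apply]
      rw [← integral_add hf hg]
      refine integral_congr_ae ?_
      filter_upwards [Lp.coeFn_add f g] with y hy
      rw [hy, Pi.add_apply, mul_add])
    (fun c f => .of_forall fun x => by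
      simp only [volumePotential, Pi.smul_apply]
      rw [← integral_smul]
      refine integral_congr_ae ?_
      filter_upwards [Lp.coeFn_smul c f] with y hy
      rw [hy, Pi.smul_apply, smul_eq_mul, smul_eq_mul, mul_left_comm])
    (fun f => by
      have h : StronglyMeasurable fun p : E3 × E3 => helmholtzKernel c₀ s p.1 p.2 * f p.2 :=
        ((measurable_helmholtzKernel c₀ s).mul
          ((Lp.stronglyMeasurable f).measurable.comp measurable_snd)).stronglyMeasurable
      exact h.integral_prod_right.aestronglyMeasurable)
    (by
      obtain ⟨C, hC, h⟩ := schur_bound hDo.measurableSet hDb c₀ s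
      refine ⟨C, hC, fun f => le_trans (lintegral_mono fun x => ?_) (h f)⟩
      exact pow_le_pow_left₀ zero_le (enorm_integral_le_lintegral_enorm _) 2)

/-- The function underlying `V̂ f` is the volume potential of `f`. -/
theorem potentialOp_coeFn {D : Set E3} (hDo : IsOpen D) (hDb : Bornology.IsBounded D) (c₀ : ℝ)
    (s : ℂ) (f : L2 D) :
    potentialOp hDo hDb c₀ s f =ᵐ[volume.restrict D] volumePotential D c₀ s f := by
  unfold potentialOp
  exact lpOperator_coeFn _ _ _ _ _ f

theorem IsContrast.exists_bound {D : Set E3} {q : E3 → ℝ} (hq : IsContrast D q) :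
    ∃ B : ℝ, 0 ≤ B ∧ ∀ᵐ x ∂volume.restrict D, 0 ≤ q x ∧ q x ≤ B ^ 2 := by
  obtain ⟨-, h⟩ := hq.memLp
  rw [eLpNorm_exponent_top] at h
  refine ⟨√(eLpNormEssSup q (volume.restrict D)).toReal, Real.sqrt_nonneg _, ?_⟩
  filter_upwards [hq.nonneg, enorm_ae_le_eLpNormEssSup q (volume.restrict D)] with x h0 h1
  refine ⟨h0, ?_⟩
  rw [Real.sq_sqrt ENNReal.toReal_nonneg]
  have := ENNReal.toReal_mono h.ne h1
  rwa [toReal_enorm, Real.norm_of_nonneg h0] at this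

theorem IsContrast.aemeasurable {D : Set E3} {q : E3 → ℝ} (hq : IsContrast D q) :
    AEMeasurable (fun x => ENNReal.ofReal (q x)) (volume.restrict D) :=
  hq.memLp.aestronglyMeasurable.aemeasurable.ennreal_ofReal

theorem IsContrast.lintegral {D : Set E3} {q : E3 → ℝ} (hq : IsContrast D q) (g : E3 → ℝ≥0∞) :
    ∫⁻ x, g x ∂weightedMeasure D q = ∫⁻ x in D, ENNReal.ofReal (q x) * g x := by
  rw [weightedMeasure, lintegral_withDensity_eq_lintegral_mul_non_measurable₀ _ hq.aemeasurable
    (.of_forall fun _ => ENNReal.ofReal_lt_top)]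
  rfl

theorem IsContrast.ae_mul {D : Set E3} {q : E3 → ℝ} (hq : IsContrast D q) {f g : E3 → ℂ}
    (h : f =ᵐ[weightedMeasure D q] g) :
    (fun x => (q x : ℂ) * f x) =ᵐ[volume.restrict D] fun x => (q x : ℂ) * g x := by
  have h' := (ae_withDensity_iff' hq.aemeasurable).1 h
  filter_upwards [h', hq.nonneg] with x hx h0
  rcases h0.eq_or_lt with h1 | h1
  · simp [← h1]
  · rw [hx (by simpa using h1)]

/-- Multiplication by the weight, `g ↦ q g`, as a bounded operator `L²_q(D) → L²(D)`. -/
def mulWeight {D : Set E3} {q : E3 → ℝ} (hq : IsContrast D q) : L2w D q →L[ℂ] L2 D :=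
  lpOperator (fun g x => (q x : ℂ) * g x)
    (fun f g => by
      filter_upwards [hq.ae_mul (Lp.coeFn_add f g)] with x hx
      rw [hx, Pi.add_apply, Pi.add_apply, mul_add])
    (fun c f => by
      filter_upwards [hq.ae_mul (Lp.coeFn_smul c f)] with x hx
      rw [hx, Pi.smul_apply, Pi.smul_apply, smul_eq_mul, smul_eq_mul, mul_left_comm])
    (fun f => (Complex.measurable_ofReal.comp_aemeasurable
      hq.memLp.aestronglyMeasurable.aemeasurable).aestronglyMeasurable.mul
        (Lp.stronglyMeasurable f).aestronglyMeasurable)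
    (by
      obtain ⟨B, hB, h⟩ := hq.exists_bound
      refine ⟨B, hB, fun f => ?_⟩
      rw [hq.lintegral, ← lintegral_const_mul' _ _ ENNReal.ofReal_ne_top]
      refine lintegral_mono_ae ?_
      filter_upwards [h] with x hx
      have e : ‖(q x : ℂ)‖ₑ = ENNReal.ofReal (q x) := by
        rw [← ofReal_norm, Complex.norm_real, Real.norm_of_nonneg hx.1]
      rw [enorm_mul, mul_pow, e, sq (ENNReal.ofReal (q x)), ← mul_assoc]
      gcongr
      exact hx.2)

theorem mulWeight_coeFn {D : Set E3} {q : E3 → ℝ} (hq : IsContrast D q) (g : L2w D q) :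
    mulWeight hq g =ᵐ[volume.restrict D] fun x => (q x : ℂ) * g x := by
  unfold mulWeight
  exact lpOperator_coeFn (fun (g : E3 → ℂ) x => (q x : ℂ) * g x) _ _ _ _ g

/-- The embedding `L²(D) → L²_q(D)`, `u ↦ u`. -/
def weightedEmbedding {D : Set E3} {q : E3 → ℝ} (hq : IsContrast D q) : L2 D →L[ℂ] L2w D q :=
  lpOperator (fun u => u)
    (fun f g => (withDensity_absolutelyContinuous _ _).ae_eq (Lp.coeFn_add f g))
    (fun c f => (withDensity_absolutelyContinuous _ _).ae_eq (Lp.coeFn_smul c f))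
    (fun f => (Lp.stronglyMeasurable f).aestronglyMeasurable)
    (by
      obtain ⟨B, hB, h⟩ := hq.exists_bound
      refine ⟨B, hB, fun f => ?_⟩
      rw [hq.lintegral, ← lintegral_const_mul' _ _ ENNReal.ofReal_ne_top]
      refine lintegral_mono_ae ?_
      filter_upwards [h] with x hx
      gcongr
      exact hx.2)

theorem weightedEmbedding_coeFn {D : Set E3} {q : E3 → ℝ} (hq : IsContrast D q) (u : L2 D) :
    weightedEmbedding hq u =ᵐ[weightedMeasure D q] u := by
  unfold weightedEmbedding
  exact lpOperator_coeFn (fun u : E3 → ℂ => u) _ _ _ _ u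

/-- `V̂_q : L²_q(D) → L²(D)`, `V̂_q g = V̂ (q g)`. -/
def weightedPotential {D : Set E3} (hDo : IsOpen D) (hDb : Bornology.IsBounded D) {q : E3 → ℝ}
    (hq : IsContrast D q) (c₀ : ℝ) (s : ℂ) : L2w D q →L[ℂ] L2 D :=
  (potentialOp hDo hDb c₀ s).comp (mulWeight hq)

/-- `(s²/c₀²) V̂_q`, regarded as an operator on `L²_q(D)`. -/
def scaledPotential {D : Set E3} (hDo : IsOpen D) (hDb : Bornology.IsBounded D) {q : E3 → ℝ}
    (hq : IsContrast D q) (c₀ : ℝ) (s : ℂ) : L2w D q →L[ℂ] L2w D q :=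
  (s ^ 2 / (c₀ : ℂ) ^ 2) • (weightedEmbedding hq).comp (weightedPotential hDo hDb hq c₀ s)

/-- The norm of `L²_q(D)` is the weighted norm. -/
theorem norm_sq_L2w {D : Set E3} {q : E3 → ℝ} (hq : IsContrast D q) (u : L2w D q) :
    ‖u‖ ^ 2 = ∫ x in D, q x * ‖u x‖ ^ 2 := by
  have h1 : ‖u‖ ^ 2 = ∫ x, ‖u x‖ ^ 2 ∂weightedMeasure D q := by
    have h := L2.inner_def (𝕜 := ℂ) u u
    simp only [inner_self_eq_norm_sq_to_K] at h
    rw [← Complex.ofReal_inj, ← integral_complex_ofReal]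
    simpa using h
  have h2 : ∀ h : E3 → ℝ, ∫ x, h x ∂weightedMeasure D q = ∫ x in D, q x * h x := fun h => by
    rw [weightedMeasure, integral_withDensity_eq_integral_toReal_smul₀ hq.aemeasurable
      (.of_forall fun _ => ENNReal.ofReal_lt_top)]
    refine integral_congr_ae ?_
    filter_upwards [hq.nonneg] with x hx
    simp [ENNReal.toReal_ofReal hx]
  rw [h1, h2]

/-- The function underlying `V̂_q g` is `x ↦ ∫_D Φ(x,y) q(y) g(y) dy`. -/
theorem weightedPotential_coeFn {D : Set E3} (hDo : IsOpen D) (hDb : Bornology.IsBounded D)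
    {q : E3 → ℝ} (hq : IsContrast D q) (c₀ : ℝ) (s : ℂ) (g : L2w D q) :
    weightedPotential hDo hDb hq c₀ s g =ᵐ[volume.restrict D]
      volumePotential D c₀ s fun y => (q y : ℂ) * g y := by
  refine (potentialOp_coeFn hDo hDb c₀ s (mulWeight hq g)).trans (.of_forall fun x => ?_)
  refine integral_congr_ae ?_
  filter_upwards [mulWeight_coeFn hq g] with y hy
  rw [hy]

end

open MeasureTheory Filter
open scoped ENNReal Ring FourierTransform

/-! Put `κ = s / c₀`, so `Re κ > 0`. The kernel is the fundamental solution of `-Δ + κ²`, and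
convolution with it on the whole space is the Fourier multiplier `1 / (t² + κ²)` with `t = 2π|ξ|`
(`fourier_yukawa`, `inner_yukawa_op`). Everything rests on `Re (conj κ · (t² + κ²)) = (t² + |κ|²) Re
κ`: it bounds the symbol by `1 / (|κ| Re κ)` and makes `Re (κ · symbol)` nonnegative. Zero extension
from `D` carries both facts to the potential `V` on `L²(D)`: `‖V‖ ≤ 1 / (|κ| Re κ)` and `Re (κ ⟨f, V
f⟩) ≥ 0`.

The embedding of `L²(D)` into the weighted space is adjoint to multiplication by `q`, and both have
norm at most `√qPlus`. Hence the scaled potential `S` has norm at most `qPlus |s| / σ`, and `⟨g, S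
g⟩ = κ² ⟨q g, V (q g)⟩`. Multiplying `⟨g, (1 + S) g⟩` by `s⁻¹` and taking real parts leaves at least
`‖g‖² σ / |s|²` (`le_norm_inner_one_add_scaledPotential`). This coercivity gives invertibility and
the bound `|s| / σ`; multiplying by the bound on `S` gives the other estimate.

For analyticity, the Taylor remainder of the kernel in `s` is controlled in operator norm by Schur's
test (`differentiableAt_potentialOp`). Complex differentiability implies analyticity, and inversion
is analytic at units. -/

/-! ### Integral operators with symmetric Schur kernels -/

/-- A symmetric measurable kernel whose rows have `L¹` norm at most `C`. -/
structure IsSchurKernel (μ : Measure E3) (k : E3 → E3 → ℂ) (C : ℝ) : Prop where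
  measurable : Measurable fun p : E3 × E3 => k p.1 p.2
  symm : ∀ x y, k x y = k y x
  nonneg : 0 ≤ C
  bound : ∀ᵐ x ∂μ, ∫⁻ y, ‖k x y‖ₑ ∂μ ≤ ENNReal.ofReal C

namespace IsSchurKernel

variable {μ : Measure E3} {k : E3 → E3 → ℂ} {C : ℝ}

theorem measurable_right (h : IsSchurKernel μ k C) (x : E3) : Measurable (k x) :=
  h.measurable.comp (measurable_const.prodMk measurable_id)

/-- Schur's test. -/
theorem lintegral_sq_le [SFinite μ] (h : IsSchurKernel μ k C) (f : Lp ℂ 2 μ) :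
    ∫⁻ x, (∫⁻ y, ‖k x y * f y‖ₑ ∂μ) ^ 2 ∂μ ≤ ENNReal.ofReal (C ^ 2) * ∫⁻ x, ‖f x‖ₑ ^ 2 ∂μ := by
  have hfm : Measurable fun y => ‖f y‖ₑ := (Lp.stronglyMeasurable f).measurable.enorm
  have hkx : ∀ x, Measurable fun y => ‖k x y‖ₑ := fun x => (h.measurable_right x).enorm
  have h1 : ∀ᵐ x ∂μ, (∫⁻ y, ‖k x y * f y‖ₑ ∂μ) ^ 2 ≤
      ENNReal.ofReal C * ∫⁻ y, ‖k x y‖ₑ * ‖f y‖ₑ ^ 2 ∂μ := by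
    filter_upwards [h.bound] with x hx
    -- Cauchy–Schwarz for the splitting `|k f| = |k|^(1/2) · (|k| |f|²)^(1/2)`; the row bound then
    -- absorbs the first factor.
    have hH := ENNReal.lintegral_mul_norm_pow_le (μ := μ)
      (f := fun y => ‖k x y‖ₑ) (g := fun y => ‖k x y‖ₑ * ‖f y‖ₑ ^ 2)
      (hkx x).aemeasurable ((hkx x).mul (hfm.pow_const 2)).aemeasurable
      (p := 1 / 2) (q := 1 / 2) (by norm_num) (by norm_num) (by norm_num)
    have hsq : ∀ a b : ℝ≥0∞, a ^ (1 / 2 : ℝ) * (a * b ^ 2) ^ (1 / 2 : ℝ) = a * b := fun a b => by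
      rw [ENNReal.mul_rpow_of_nonneg _ _ (by norm_num), ← mul_assoc,
        ← ENNReal.rpow_add_of_nonneg _ _ (by norm_num) (by norm_num), ← ENNReal.rpow_natCast,
        ← ENNReal.rpow_mul]
      norm_num
    simp only [hsq] at hH
    simp only [enorm_mul]
    calc _ ≤ _ := pow_le_pow_left₀ zero_le hH 2
      _ = (∫⁻ y, ‖k x y‖ₑ ∂μ) * ∫⁻ y, ‖k x y‖ₑ * ‖f y‖ₑ ^ 2 ∂μ := by
        rw [mul_pow, ← ENNReal.rpow_natCast, ← ENNReal.rpow_natCast, ← ENNReal.rpow_mul,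
          ← ENNReal.rpow_mul]
        norm_num
      _ ≤ _ := by gcongr
  calc ∫⁻ x, (∫⁻ y, ‖k x y * f y‖ₑ ∂μ) ^ 2 ∂μ
      ≤ ∫⁻ x, ENNReal.ofReal C * ∫⁻ y, ‖k x y‖ₑ * ‖f y‖ₑ ^ 2 ∂μ ∂μ := lintegral_mono_ae h1
    _ = ENNReal.ofReal C * ∫⁻ x, ∫⁻ y, ‖k x y‖ₑ * ‖f y‖ₑ ^ 2 ∂μ ∂μ :=
        lintegral_const_mul' _ _ ENNReal.ofReal_ne_top
    _ = ENNReal.ofReal C * ∫⁻ y, ∫⁻ x, ‖k x y‖ₑ * ‖f y‖ₑ ^ 2 ∂μ ∂μ := by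
        rw [lintegral_lintegral_swap]
        exact (h.measurable.enorm.mul ((hfm.comp measurable_snd).pow_const 2)).aemeasurable
    _ ≤ ENNReal.ofReal C * ∫⁻ y, ENNReal.ofReal C * ‖f y‖ₑ ^ 2 ∂μ := by
        refine mul_le_mul_right (lintegral_mono_ae ?_) _
        filter_upwards [h.bound] with y hy
        -- Symmetry turns the column integral left by Tonelli into a row integral, so the same
        -- constant appears twice.
        simp_rw [h.symm _ y]
        rw [lintegral_mul_const _ (hkx y)]
        gcongr
    _ = ENNReal.ofReal (C ^ 2) * ∫⁻ x, ‖f x‖ₑ ^ 2 ∂μ := by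
        rw [lintegral_const_mul' _ _ ENNReal.ofReal_ne_top, ← mul_assoc, sq,
          ENNReal.ofReal_mul h.nonneg]

theorem ae_integrable [SFinite μ] (h : IsSchurKernel μ k C) (f : Lp ℂ 2 μ) :
    ∀ᵐ x ∂μ, Integrable (fun y => k x y * f y) μ := by
  have hf : Measurable f := (Lp.stronglyMeasurable f).measurable
  have hfin : ∫⁻ x, ‖f x‖ₑ ^ 2 ∂μ ≠ ∞ := by
    have := lintegral_rpow_enorm_lt_top_of_eLpNorm_lt_top two_ne_zero ENNReal.ofNat_ne_top
      (Lp.memLp f).eLpNorm_lt_top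
    simpa using this.ne
  have hm : Measurable fun x => (∫⁻ y, ‖k x y * f y‖ₑ ∂μ) ^ 2 :=
    (Measurable.lintegral_prod_right' (f := fun p : E3 × E3 => ‖k p.1 p.2 * f p.2‖ₑ)
      (h.measurable.mul (hf.comp measurable_snd)).enorm).pow_const 2
  filter_upwards [ae_lt_top hm ((h.lintegral_sq_le f).trans_lt
    (ENNReal.mul_lt_top ENNReal.ofReal_lt_top hfin.lt_top)).ne] with x hx
  refine ⟨((h.measurable_right x).mul hf).aestronglyMeasurable, ?_⟩
  exact lt_top_iff_ne_top.2 fun h0 => by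
    rw [h0] at hx
    simp at hx

theorem stronglyMeasurable_integral [SFinite μ] (h : IsSchurKernel μ k C) (f : Lp ℂ 2 μ) :
    StronglyMeasurable fun x => ∫ y, k x y * f y ∂μ :=
  StronglyMeasurable.integral_prod_right (f := fun x y => k x y * f y) (h.measurable.mul
    ((Lp.stronglyMeasurable f).measurable.comp measurable_snd)).stronglyMeasurable

theorem lintegral_integral_sq_le [SFinite μ] (h : IsSchurKernel μ k C) (f : Lp ℂ 2 μ) :
    ∫⁻ x, ‖∫ y, k x y * f y ∂μ‖ₑ ^ 2 ∂μ ≤ ENNReal.ofReal (C ^ 2) * ∫⁻ x, ‖f x‖ₑ ^ 2 ∂μ :=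
  le_trans (lintegral_mono fun _ => pow_le_pow_left₀ zero_le
    (enorm_integral_le_lintegral_enorm _) 2) (h.lintegral_sq_le f)

/-- The bounded operator on `L²` with a given kernel. -/
noncomputable def op [SFinite μ] (h : IsSchurKernel μ k C) : Lp ℂ 2 μ →L[ℂ] Lp ℂ 2 μ :=
  lpOperator (fun f x => ∫ y, k x y * f y ∂μ)
    (fun f g => by
      filter_upwards [h.ae_integrable f, h.ae_integrable g] with x hf hg
      simp only [Pi.add_apply]
      rw [← integral_add hf hg]
      refine integral_congr_ae ?_
      filter_upwards [Lp.coeFn_add f g] with y hy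
      rw [hy, Pi.add_apply, mul_add])
    (fun c f => .of_forall fun x => by
      simp only [Pi.smul_apply]
      rw [← integral_smul]
      refine integral_congr_ae ?_
      filter_upwards [Lp.coeFn_smul c f] with y hy
      rw [hy, Pi.smul_apply, smul_eq_mul, smul_eq_mul, mul_left_comm])
    (fun f => (h.stronglyMeasurable_integral f).aestronglyMeasurable)
    ⟨C, h.nonneg, h.lintegral_integral_sq_le⟩

theorem op_coeFn [SFinite μ] (h : IsSchurKernel μ k C) (f : Lp ℂ 2 μ) :
    h.op f =ᵐ[μ] fun x => ∫ y, k x y * f y ∂μ := by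
  unfold op
  exact lpOperator_coeFn _ _ _ _ _ f

theorem norm_op_le [SFinite μ] (h : IsSchurKernel μ k C) : ‖h.op‖ ≤ C := by
  refine ContinuousLinearMap.opNorm_le_bound _ h.nonneg fun f => ?_
  rw [Lp.norm_def, Lp.norm_def, eLpNorm_congr_ae (h.op_coeFn f),
    ← ENNReal.toReal_ofReal h.nonneg, ← ENNReal.toReal_mul]
  simpa only [ENNReal.toReal_ofReal h.nonneg] using
    ENNReal.toReal_mono (ENNReal.mul_ne_top ENNReal.ofReal_ne_top
      (Lp.memLp f).eLpNorm_lt_top.ne) (eLpNorm_le_of_sq h.nonneg (h.lintegral_integral_sq_le f))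

/-- A bounded symmetric kernel on a set of finite measure satisfies Schur's condition. -/
theorem of_bounded {D : Set E3} (hDm : MeasurableSet D) (hD : volume D ≠ ∞)
    (hm : Measurable fun p : E3 × E3 => k p.1 p.2) (hs : ∀ x y, k x y = k y x)
    {B : ℝ} (hB : 0 ≤ B) (hk : ∀ x ∈ D, ∀ y ∈ D, ‖k x y‖ ≤ B) :
    IsSchurKernel (volume.restrict D) k (B * volume.real D) where
  measurable := hm
  symm := hs
  nonneg := by positivity
  bound := by
    refine (ae_restrict_iff' hDm).2 (.of_forall fun x hx => ?_)
    calc ∫⁻ y in D, ‖k x y‖ₑ ≤ ∫⁻ _ in D, ENNReal.ofReal B :=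
          setLIntegral_mono' hDm fun y hy => by
            rw [← ofReal_norm]
            exact ENNReal.ofReal_le_ofReal (hk x hx y hy)
      _ = ENNReal.ofReal (B * volume.real D) := by
          rw [lintegral_const, Measure.restrict_apply_univ, ENNReal.ofReal_mul hB,
            ofReal_measureReal hD]

end IsSchurKernel

theorem exists_isSchurKernel_helmholtz {D : Set E3} (hDm : MeasurableSet D)
    (hDb : Bornology.IsBounded D) (c₀ : ℝ) (s : ℂ) :
    ∃ C, IsSchurKernel (volume.restrict D) (helmholtzKernel c₀ s) C := by
  obtain ⟨C, hC, h⟩ := helmholtzKernel_bound hDb c₀ s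
  exact ⟨C, measurable_helmholtzKernel c₀ s, helmholtzKernel_comm c₀ s, hC,
    (ae_restrict_iff' hDm).2 (.of_forall h)⟩

/-! ### The Yukawa kernel and its Fourier transform -/

/-- The fundamental solution `exp(-κ|x|) / (4π|x|)` of `-Δ + κ²` in three dimensions. -/
noncomputable def yukawa (κ : ℂ) (x : E3) : ℂ :=
  Complex.exp (-κ * (‖x‖ : ℂ)) / (4 * (Real.pi : ℂ) * (‖x‖ : ℂ))

theorem helmholtzKernel_eq_yukawa (c₀ : ℝ) (s : ℂ) (x y : E3) :
    helmholtzKernel c₀ s x y = yukawa (s / c₀) (x - y) := by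
  unfold helmholtzKernel yukawa
  congr 2
  ring

theorem measurable_yukawa (κ : ℂ) : Measurable (yukawa κ) := by
  unfold yukawa
  fun_prop

/-- In polar coordinates the Jacobian `r²` beats the singularity `1/r`, leaving the integrable
majorant `r exp(-r Re κ)`. -/
theorem integrable_yukawa {κ : ℂ} (hκ : 0 < κ.re) : Integrable (yukawa κ) := by
  refine (integrable_fun_norm_addHaar (E := E3) volume
    (f := fun r : ℝ => Complex.exp (-κ * (r : ℂ)) / (4 * (Real.pi : ℂ) * (r : ℂ)))).2 ?_
  have h := integrableOn_rpow_mul_exp_neg_mul_rpow (p := 1) (s := 1) (b := κ.re)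
    (by norm_num) one_pos hκ
  refine Integrable.mono' h (by fun_prop) ?_
  refine (ae_restrict_iff' measurableSet_Ioi).2 (.of_forall fun r (hr : 0 < r) => ?_)
  simp only [finrank_euclideanSpace, Fintype.card_fin, norm_smul, norm_div, Complex.norm_exp,
    norm_mul, Complex.norm_real, Real.rpow_one, Real.norm_of_nonneg hr.le, norm_pow]
  have e : (-κ * (r : ℂ)).re = -κ.re * r := by simp
  rw [e, Real.norm_of_nonneg Real.pi_pos.le]
  have : r ^ (3 - 1) * (Real.exp (-κ.re * r) / (‖(4 : ℂ)‖ * Real.pi * r)) =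
      r * Real.exp (-κ.re * r) / (4 * Real.pi) := by
    simp
    field_simp
  rw [this]
  refine div_le_self (by positivity) ?_
  linarith [Real.pi_gt_three]

theorem integrableOn_exp_neg_mul_sqrt {κ : ℂ} (hκ : 0 < κ.re) (t : ℝ) :
    IntegrableOn (fun y : ℝ => Complex.exp (-κ * (√(t ^ 2 + y ^ 2) : ℝ)) *
      ((y / √(t ^ 2 + y ^ 2) : ℝ) : ℂ)) (Set.Ioi 0) := by
  have h : IntegrableOn (fun y : ℝ => Real.exp (-κ.re * y)) (Set.Ioi 0) :=
    exp_neg_integrableOn_Ioi 0 hκ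
  refine Integrable.mono' h (by fun_prop) ?_
  refine (ae_restrict_iff' measurableSet_Ioi).2 (.of_forall fun y (hy : 0 < y) => ?_)
  have h1 : y ≤ √(t ^ 2 + y ^ 2) := Real.le_sqrt_of_sq_le (by nlinarith [sq_nonneg t])
  rw [norm_mul, Complex.norm_exp, Complex.norm_real, Real.norm_of_nonneg (by positivity)]
  have e : (-κ * (√(t ^ 2 + y ^ 2) : ℝ)).re = -κ.re * √(t ^ 2 + y ^ 2) := by simp
  rw [e]
  refine (mul_le_of_le_one_right (by positivity) (div_le_one_of_le₀ h1 (by positivity))).trans ?_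
  refine Real.exp_le_exp.2 ?_
  nlinarith

theorem tendsto_exp_neg_mul_atTop {κ : ℂ} (hκ : 0 < κ.re) :
    Tendsto (fun r : ℝ => Complex.exp (-κ * (r : ℂ))) atTop (nhds 0) := by
  rw [tendsto_zero_iff_norm_tendsto_zero]
  have e : ∀ r : ℝ, ‖Complex.exp (-κ * (r : ℂ))‖ = Real.exp (-(κ.re * r)) := fun r => by
    rw [Complex.norm_exp]
    simp
  simp only [e]
  exact Real.tendsto_exp_neg_atTop_nhds_zero.comp (tendsto_id.const_mul_atTop hκ)

/-- The integrand has the primitive `-exp(-κ √(t² + y²)) / κ`, which vanishes at infinity. The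
condition `t ≠ 0` keeps the square root differentiable at `y = 0`. -/
theorem integral_exp_neg_mul_sqrt {κ : ℂ} (hκ : 0 < κ.re) {t : ℝ} (ht : t ≠ 0) :
    ∫ y : ℝ in Set.Ioi 0, Complex.exp (-κ * (√(t ^ 2 + y ^ 2) : ℝ)) *
      ((y / √(t ^ 2 + y ^ 2) : ℝ) : ℂ) = Complex.exp (-κ * (|t| : ℝ)) / κ := by
  have hκ0 : κ ≠ 0 := fun h => by simp [h] at hκ
  have hd : ∀ y ∈ Set.Ici (0 : ℝ), HasDerivAt
      (fun y : ℝ => -(Complex.exp (-κ * (√(t ^ 2 + y ^ 2) : ℝ)) / κ))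
      (Complex.exp (-κ * (√(t ^ 2 + y ^ 2) : ℝ)) * ((y / √(t ^ 2 + y ^ 2) : ℝ) : ℂ)) y := by
    intro y _
    have hp : t ^ 2 + y ^ 2 ≠ 0 := by positivity
    have h1 : HasDerivAt (fun y : ℝ => √(t ^ 2 + y ^ 2)) (y / √(t ^ 2 + y ^ 2)) y := by
      convert! (((hasDerivAt_pow 2 y).const_add (t ^ 2)).sqrt hp) using 1
      field_simp
      norm_num [mul_comm]
    convert! (((h1.ofReal_comp.const_mul (-κ)).cexp.div_const κ).neg) using 1
    field_simp
  have hlim : Tendsto (fun y : ℝ => -(Complex.exp (-κ * (√(t ^ 2 + y ^ 2) : ℝ)) / κ)) atTop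
      (nhds 0) := by
    have h2 : Tendsto (fun y : ℝ => √(t ^ 2 + y ^ 2)) atTop atTop :=
      tendsto_atTop_mono
        (fun y => Real.le_sqrt_of_sq_le (le_add_of_nonneg_left (sq_nonneg t))) tendsto_id
    simpa using (((tendsto_exp_neg_mul_atTop hκ).comp h2).div_const κ).neg
  rw [integral_Ioi_of_hasDerivAt_of_tendsto' hd (integrableOn_exp_neg_mul_sqrt hκ t) hlim]
  simp [Real.sqrt_sq_eq_abs]

/-- The integral of `exp(-κ|x|) / (4π|x|)` over a plane at distance `|t|` from the origin. -/
theorem integral_yukawa_plane {κ : ℂ} (hκ : 0 < κ.re) {t : ℝ} (ht : t ≠ 0) :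
    ∫ z : ℂ, Complex.exp (-κ * (√(t ^ 2 + ‖z‖ ^ 2) : ℝ)) /
      (4 * (Real.pi : ℂ) * (√(t ^ 2 + ‖z‖ ^ 2) : ℝ)) = Complex.exp (-κ * (|t| : ℝ)) / (2 * κ) := by
  -- Polar coordinates in the plane: the Jacobian `r` supplies the numerator of `r / √(t² + r²)`,
  -- which makes the radial integral elementary.
  rw [integral_fun_norm_addHaar (E := ℂ) volume (fun r : ℝ =>
    Complex.exp (-κ * (√(t ^ 2 + r ^ 2) : ℝ)) / (4 * (Real.pi : ℂ) * (√(t ^ 2 + r ^ 2) : ℝ)))]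
  have hv : volume.real (Metric.ball (0 : ℂ) 1) = Real.pi := by
    rw [Measure.real, Complex.volume_ball]
    simp
  have hi : ∫ y : ℝ in Set.Ioi 0, y ^ (Module.finrank ℝ ℂ - 1) •
      (Complex.exp (-κ * (√(t ^ 2 + y ^ 2) : ℝ)) / (4 * (Real.pi : ℂ) * (√(t ^ 2 + y ^ 2) : ℝ))) =
      (1 / (4 * (Real.pi : ℂ))) * (Complex.exp (-κ * (|t| : ℝ)) / κ) := by
    rw [← integral_exp_neg_mul_sqrt hκ ht, ← integral_const_mul]
    refine integral_congr_ae (.of_forall fun y => ?_)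
    simp only [Complex.finrank_real_complex, Complex.real_smul]
    push_cast
    ring
  rw [hv, hi, Complex.finrank_real_complex]
  have hπ : (Real.pi : ℂ) ≠ 0 := by exact_mod_cast Real.pi_ne_zero
  have hκ0 : κ ≠ 0 := fun h => by simp [h] at hκ
  simp only [nsmul_eq_mul, Complex.real_smul]
  push_cast
  field_simp
  norm_num

/-- Euclidean three-space as the product of an axis and a plane. -/
noncomputable def axisPlane : E3 ≃ᵐ ℝ × ℂ :=
  (MeasurableEquiv.toLp 2 (Fin 3 → ℝ)).symm.trans
    ((MeasurableEquiv.piFinSuccAbove (fun _ : Fin 3 => ℝ) 0).trans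
      (MeasurableEquiv.prodCongr (MeasurableEquiv.refl ℝ) Complex.measurableEquivPi.symm))

theorem measurePreserving_axisPlane : MeasurePreserving axisPlane volume volume :=
  ((MeasurePreserving.id volume).prod Complex.volume_preserving_equiv_pi.symm).comp
    ((volume_preserving_piFinSuccAbove (fun _ : Fin 3 => ℝ) 0).comp
      (EuclideanSpace.volume_preserving_symm_measurableEquiv_toLp (Fin 3)))

theorem axisPlane_fst (x : E3) : (axisPlane x).1 = x 0 := rfl

theorem axisPlane_snd (x : E3) : (axisPlane x).2 = ⟨x 1, x 2⟩ := by
  change Complex.measurableEquivPi.symm ![x 1, x 2] = _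
  rw [Complex.measurableEquivPi_symm_apply]
  apply Complex.ext <;> simp

theorem norm_eq_sqrt_axisPlane (x : E3) :
    ‖x‖ = √((axisPlane x).1 ^ 2 + ‖(axisPlane x).2‖ ^ 2) := by
  rw [EuclideanSpace.norm_eq, Fin.sum_univ_three, axisPlane_fst, axisPlane_snd, Complex.sq_norm,
    Complex.normSq_mk]
  simp only [Real.norm_eq_abs, sq_abs]
  congr 1
  ring

/-- The two half-lines contribute `1 / (κ - ia)` and `1 / (κ + ia)`, each with the factor `1 /
(2κ)`. -/
theorem integral_exp_neg_abs_mul_exp {κ : ℂ} (hκ : 0 < κ.re) (a : ℝ) :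
    ∫ t : ℝ, Complex.exp (-κ * (|t| : ℝ)) / (2 * κ) * Complex.exp (-(a * t) * Complex.I) =
      1 / (a ^ 2 + κ ^ 2) := by
  have hre1 : (-κ - a * Complex.I).re < 0 := by simpa using hκ
  have hre2 : 0 < (κ - a * Complex.I).re := by simpa using hκ
  have h1 : ∀ t ∈ Set.Ioi (0 : ℝ), Complex.exp (-κ * (|t| : ℝ)) / (2 * κ) *
      Complex.exp (-(a * t) * Complex.I) =
      (1 / (2 * κ)) * Complex.exp ((-κ - a * Complex.I) * t) := fun t (ht : 0 < t) => by
    rw [abs_of_pos ht, div_mul_eq_mul_div, ← Complex.exp_add, div_eq_mul_one_div, mul_comm]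
    ring_nf
  have h2 : ∀ t ∈ Set.Iic (0 : ℝ), Complex.exp (-κ * (|t| : ℝ)) / (2 * κ) *
      Complex.exp (-(a * t) * Complex.I) =
      (1 / (2 * κ)) * Complex.exp ((κ - a * Complex.I) * t) := fun t (ht : t ≤ 0) => by
    rw [abs_of_nonpos ht, div_mul_eq_mul_div, ← Complex.exp_add, div_eq_mul_one_div, mul_comm]
    push_cast
    ring_nf
  rw [← intervalIntegral.integral_Iic_add_Ioi (b := 0)
    (IntegrableOn.congr_fun ((integrableOn_exp_mul_complex_Iic hre2 0).const_mul _)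
      (fun t ht => (h2 t ht).symm) measurableSet_Iic)
    (IntegrableOn.congr_fun ((integrableOn_exp_mul_complex_Ioi hre1 0).const_mul _)
      (fun t ht => (h1 t ht).symm) measurableSet_Ioi),
    setIntegral_congr_fun measurableSet_Ioi h1, setIntegral_congr_fun measurableSet_Iic h2,
    integral_const_mul, integral_const_mul, integral_exp_mul_complex_Ioi hre1,
    integral_exp_mul_complex_Iic hre2]
  have hκ0 : κ ≠ 0 := fun h => by simp [h] at hκ
  have n1 : -κ - a * Complex.I ≠ 0 := fun h => by simp [h] at hre1
  have n2 : κ - a * Complex.I ≠ 0 := fun h => by simp [h] at hre2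
  have n3 : (a : ℂ) ^ 2 + κ ^ 2 = -((-κ - a * Complex.I) * (κ - a * Complex.I)) := by
    ring_nf
    simp
  rw [n3]
  simp only [Complex.ofReal_zero, mul_zero, Complex.exp_zero]
  field_simp
  ring

/-- The phase is constant on the planes orthogonal to the axis. Fubini therefore reduces the
transform to the plane integrals, followed by a one-dimensional Fourier transform. -/
theorem integral_yukawa_mul_exp_axis {κ : ℂ} (hκ : 0 < κ.re) (a : ℝ) :
    ∫ x : E3, yukawa κ x * Complex.exp (-(a * x 0) * Complex.I) = 1 / (a ^ 2 + κ ^ 2) := by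
  set G : ℝ × ℂ → ℂ := fun p => Complex.exp (-κ * (√(p.1 ^ 2 + ‖p.2‖ ^ 2) : ℝ)) /
    (4 * (Real.pi : ℂ) * (√(p.1 ^ 2 + ‖p.2‖ ^ 2) : ℝ)) * Complex.exp (-(a * p.1) * Complex.I)
    with hG
  have hGx : ∀ x : E3, yukawa κ x * Complex.exp (-(a * x 0) * Complex.I) = G (axisPlane x) :=
    fun x => by
      rw [yukawa, norm_eq_sqrt_axisPlane]
      rfl
  have hint : Integrable G := by
    rw [← measurePreserving_axisPlane.integrable_comp_emb axisPlane.measurableEmbedding]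
    have : Integrable fun x : E3 => yukawa κ x * Complex.exp (-(a * x 0) * Complex.I) := by
      refine (integrable_yukawa hκ).mul_bdd (c := 1) (by fun_prop) (.of_forall fun x => ?_)
      rw [← Complex.ofReal_mul, ← Complex.ofReal_neg, Complex.norm_exp_ofReal_mul_I]
    exact this.congr (.of_forall hGx)
  simp_rw [hGx]
  rw [measurePreserving_axisPlane.integral_comp', Measure.volume_eq_prod, integral_prod _ hint,
    ← integral_exp_neg_abs_mul_exp hκ a]
  refine integral_congr_ae ?_
  -- The plane integral was computed only off the origin; the excluded plane is a null slice.
  have h0 : ∀ᵐ t : ℝ, t ≠ 0 := Measure.ae_ne volume 0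
  filter_upwards [h0] with t ht
  rw [hG]
  dsimp only
  rw [integral_mul_const, integral_yukawa_plane hκ ht]

theorem exists_orthonormalBasis_axis (ξ : E3) :
    ∃ b : OrthonormalBasis (Fin 3) ℝ E3, ξ = ‖ξ‖ • b 0 := by
  rcases eq_or_ne ξ 0 with rfl | hξ
  · exact ⟨EuclideanSpace.basisFun _ _, by simp⟩
  · have hn : ‖ξ‖ ≠ 0 := norm_ne_zero_iff.2 hξ
    obtain ⟨b, hb⟩ := Orthonormal.exists_orthonormalBasis_extension_of_card_eq (𝕜 := ℝ) (E := E3)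
      (ι := Fin 3) (by simp) (v := fun _ => ‖ξ‖⁻¹ • ξ) (s := {0})
      ⟨fun i => by simp [norm_smul, hn], fun i j hij => (hij (Subsingleton.elim _ _)).elim⟩
    exact ⟨b, by rw [hb 0 rfl, smul_smul, mul_inv_cancel₀ hn, one_smul]⟩

/-- The Fourier transform of `exp(-κ|x|) / (4π|x|)`. -/
theorem fourier_yukawa {κ : ℂ} (hκ : 0 < κ.re) (ξ : E3) :
    𝓕 (yukawa κ) ξ = 1 / ((2 * Real.pi * ‖ξ‖ : ℝ) ^ 2 + κ ^ 2) := by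
  -- The kernel is radial, so an isometry taking `ξ` to the first axis reduces to the axial case
  -- with `a = 2π‖ξ‖`.
  obtain ⟨b, hb⟩ := exists_orthonormalBasis_axis ξ
  rw [Real.fourier_eq', ← integral_yukawa_mul_exp_axis hκ,
    ← b.measurePreserving_repr.integral_comp b.repr.toHomeomorph.measurableEmbedding
      (fun y : E3 => yukawa κ y * Complex.exp (-((2 * Real.pi * ‖ξ‖ : ℝ) * y 0) * Complex.I))]
  refine integral_congr_ae (.of_forall fun x => ?_)
  have h1 : inner ℝ x ξ = ‖ξ‖ * b.repr x 0 := by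
    conv_lhs => rw [hb]
    rw [inner_smul_right, b.repr_apply_apply, real_inner_comm]
  have h2 : yukawa κ (b.repr x) = yukawa κ x := by
    simp only [yukawa, b.repr.norm_map]
  dsimp only
  rw [h1, h2, smul_eq_mul, mul_comm]
  congr 2
  push_cast
  ring

/-! ### Convolution with the Yukawa kernel as a Fourier multiplier -/

/-- Adjointness of the Fourier transform, with one factor merely integrable. -/
theorem integral_inner_fourier_of_integrable (h : SchwartzMap E3 ℂ) {u : E3 → ℂ}
    (hu : Integrable u) : ∫ x, inner ℂ (h x) (u x) = ∫ ξ, inner ℂ (𝓕 h ξ) (𝓕 u ξ) := by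
  -- The pairing `-innerₗ E3` makes the transform on the left the inverse one; applied to `𝓕 h` it
  -- returns `h`, while `u` receives the forward transform.
  have key := VectorFourier.integral_sesq_fourierIntegral_eq_neg_flip (innerSL ℂ (E := ℂ))
    (μ := (volume : Measure E3)) (ν := (volume : Measure E3)) (L := -innerₗ E3)
    Real.continuous_fourierChar (by simpa using! continuous_inner.neg)
    (𝓕 h : SchwartzMap E3 ℂ).integrable hu
  have h1 : ∀ x, VectorFourier.fourierIntegral Real.fourierChar volume (-innerₗ E3)
      (𝓕 h : SchwartzMap E3 ℂ) x =
      h x := fun x => by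
    have : (𝓕⁻ (𝓕 h) : SchwartzMap E3 ℂ) x = h x := by
      rw [FourierTransform.fourierInv_fourier_eq]
    rw [← this, SchwartzMap.fourierInv_coe, Real.fourierInv_eq, VectorFourier.fourierIntegral]
    simp
  have h2 : ∀ ξ, VectorFourier.fourierIntegral Real.fourierChar volume (-(-innerₗ E3).flip) u ξ =
      𝓕 u ξ := fun ξ => by
    rw [Real.fourier_eq, VectorFourier.fourierIntegral]
    simp [real_inner_comm]
  simpa only [h1, h2, innerSL_apply_apply] using key

theorem isSchurKernel_yukawa {κ : ℂ} (hκ : 0 < κ.re) :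
    IsSchurKernel volume (fun x y => yukawa κ (x - y)) (∫ x, ‖yukawa κ x‖) where
  measurable := (measurable_yukawa κ).comp (measurable_fst.sub measurable_snd)
  symm x y := by simp only [yukawa, norm_sub_rev x y]
  nonneg := integral_nonneg fun _ => norm_nonneg _
  bound := .of_forall fun x => by
    rw [lintegral_sub_left_eq_self (fun z => ‖yukawa κ z‖ₑ) x,
      ofReal_integral_norm_eq_lintegral_enorm (integrable_yukawa hκ)]

/-- The Fourier symbol of convolution with `exp(-κ|x|) / (4π|x|)`. -/
noncomputable def yukawaSymbol (κ : ℂ) (ξ : E3) : ℂ :=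
  1 / ((2 * Real.pi * ‖ξ‖ : ℝ) ^ 2 + κ ^ 2)

/-- Multiplying by `conj κ` turns `κ²` into `|κ|² κ`, so both summands have nonnegative real part,
and the one with `t²` can be dropped. -/
theorem le_re_conj_mul_sq_add_sq {κ : ℂ} (hκ : 0 < κ.re) (t : ℝ) :
    ‖κ‖ ^ 2 * κ.re ≤ (starRingEnd ℂ κ * ((t : ℂ) ^ 2 + κ ^ 2)).re := by
  have : (starRingEnd ℂ κ * ((t : ℂ) ^ 2 + κ ^ 2)).re = t ^ 2 * κ.re + ‖κ‖ ^ 2 * κ.re := by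
    rw [Complex.sq_norm, Complex.normSq_apply, ← Complex.ofReal_pow]
    simp only [Complex.mul_re, Complex.add_re, Complex.add_im, Complex.conj_re, Complex.conj_im,
      Complex.ofReal_re, Complex.ofReal_im, pow_two, Complex.mul_im]
    ring
  rw [this]
  nlinarith [mul_nonneg (sq_nonneg t) hκ.le]

theorem norm_yukawaSymbol_le {κ : ℂ} (hκ : 0 < κ.re) (ξ : E3) :
    ‖yukawaSymbol κ ξ‖ ≤ 1 / (‖κ‖ * κ.re) := by
  have hn : 0 < ‖κ‖ := norm_pos_iff.2 fun h => by simp [h] at hκ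
  rw [yukawaSymbol, norm_div, norm_one]
  refine one_div_le_one_div_of_le (by positivity) ?_
  have h := (le_re_conj_mul_sq_add_sq hκ (2 * Real.pi * ‖ξ‖)).trans (Complex.re_le_norm _)
  rw [norm_mul, RCLike.norm_conj, pow_two, mul_assoc] at h
  exact le_of_mul_le_mul_left h hn

/-- For `w = t² + κ²`, the number `κ / w` has the same real part as `conj κ · w / |w|²`. -/
theorem re_mul_yukawaSymbol_nonneg {κ : ℂ} (hκ : 0 < κ.re) (ξ : E3) :
    0 ≤ (κ * yukawaSymbol κ ξ).re := by
  have h := (le_re_conj_mul_sq_add_sq hκ (2 * Real.pi * ‖ξ‖))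
  have h0 : 0 ≤ ‖κ‖ ^ 2 * κ.re := by positivity
  set w := ((2 * Real.pi * ‖ξ‖ : ℝ) : ℂ) ^ 2 + κ ^ 2 with hw
  have e : (κ * (1 / w)).re = (starRingEnd ℂ κ * w).re / Complex.normSq w := by
    simp only [one_div, Complex.mul_re, Complex.inv_re, Complex.inv_im, Complex.conj_re,
      Complex.conj_im]
    ring
  rw [yukawaSymbol, ← hw, e]
  exact div_nonneg (h0.trans h) (Complex.normSq_nonneg _)

theorem measurable_yukawaSymbol (κ : ℂ) : Measurable (yukawaSymbol κ) := by
  unfold yukawaSymbol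
  fun_prop

theorem memLp_yukawaSymbol_mul {κ : ℂ} (hκ : 0 < κ.re) (g : SchwartzMap E3 ℂ) :
    MemLp (fun ξ => yukawaSymbol κ ξ * g ξ) 2 :=
  (g.memLp 2).of_le_mul ((measurable_yukawaSymbol κ).aestronglyMeasurable.mul
    (g.memLp 2).aestronglyMeasurable) (c := 1 / (‖κ‖ * κ.re)) (.of_forall fun ξ => by
      rw [norm_mul]
      gcongr
      exact norm_yukawaSymbol_le hκ ξ)

/-- Convolution with `exp(-κ|x|) / (4π|x|)` acts as a Fourier multiplier. -/
theorem inner_yukawa_op {κ : ℂ} (hκ : 0 < κ.re) (h f : SchwartzMap E3 ℂ) :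
    inner ℂ (h.toLp 2) ((isSchurKernel_yukawa hκ).op (f.toLp 2)) =
      ∫ ξ, inner ℂ (𝓕 h ξ) (yukawaSymbol κ ξ * 𝓕 f ξ) := by
  have hconv : Integrable (convolution f (yukawa κ) (ContinuousLinearMap.mul ℂ ℂ) volume) :=
    f.integrable.integrable_convolution _ (integrable_yukawa hκ)
  rw [L2.inner_def]
  calc _ = ∫ x, inner ℂ (h x)
        (convolution f (yukawa κ) (ContinuousLinearMap.mul ℂ ℂ) volume x) := by
        refine integral_congr_ae ?_
        filter_upwards [h.coeFn_toLp 2, (isSchurKernel_yukawa hκ).op_coeFn (f.toLp 2)] with x h1 h2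
        rw [h1, h2]
        congr 1
        refine integral_congr_ae ?_
        filter_upwards [f.coeFn_toLp 2] with y hy
        rw [hy, ContinuousLinearMap.mul_apply', mul_comm]
    _ = _ := by
        rw [integral_inner_fourier_of_integrable h hconv]
        refine integral_congr_ae (.of_forall fun ξ => ?_)
        dsimp only
        rw [Real.fourier_mul_convolution_eq f.integrable (integrable_yukawa hκ), fourier_yukawa hκ,
          SchwartzMap.fourier_coe f, yukawaSymbol, mul_comm]

/-- On Schwartz functions this is Cauchy–Schwarz on the Fourier side, the bound on the symbol and
Plancherel; both sides are continuous, so density gives all of `L²`. -/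
theorem norm_inner_yukawa_op_le {κ : ℂ} (hκ : 0 < κ.re) (h f : Lp ℂ 2 (volume : Measure E3)) :
    ‖inner ℂ h ((isSchurKernel_yukawa hκ).op f)‖ ≤ 1 / (‖κ‖ * κ.re) * ‖h‖ * ‖f‖ := by
  refine (SchwartzMap.denseRange_toLpCLM (E := E3) (F := ℂ) (p := 2) (μ := volume)
    ENNReal.ofNat_ne_top).induction_on₂ (p := fun h f =>
      ‖inner ℂ h ((isSchurKernel_yukawa hκ).op f)‖ ≤ 1 / (‖κ‖ * κ.re) * ‖h‖ * ‖f‖)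
    (isClosed_le (by fun_prop) (by fun_prop)) (fun h f => ?_) h f
  rw [SchwartzMap.toLpCLM_apply, SchwartzMap.toLpCLM_apply, inner_yukawa_op hκ]
  have hm := memLp_yukawaSymbol_mul hκ (𝓕 f)
  have e : ∫ ξ, inner ℂ (𝓕 h ξ) (yukawaSymbol κ ξ * 𝓕 f ξ) =
      inner ℂ ((𝓕 h).toLp 2) (hm.toLp _) := by
    rw [L2.inner_def]
    refine integral_congr_ae ?_
    filter_upwards [(𝓕 h).coeFn_toLp 2, hm.coeFn_toLp] with ξ h1 h2
    rw [h1, h2]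
  have hle : ‖hm.toLp _‖ ≤ 1 / (‖κ‖ * κ.re) * ‖(𝓕 f).toLp 2 volume‖ := by
    refine Lp.norm_le_mul_norm_of_ae_le_mul ?_
    filter_upwards [(𝓕 f).coeFn_toLp 2, hm.coeFn_toLp] with ξ h1 h2
    rw [h1, h2, norm_mul]
    gcongr
    exact norm_yukawaSymbol_le hκ ξ
  rw [e]
  refine (norm_inner_le_norm _ _).trans ?_
  rw [SchwartzMap.norm_fourier_toL2_eq] at hle ⊢
  calc _ ≤ ‖h.toLp 2 volume‖ * (1 / (‖κ‖ * κ.re) * ‖f.toLp 2 volume‖) := by gcongr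
    _ = _ := by ring

theorem re_mul_inner_yukawa_op_nonneg {κ : ℂ} (hκ : 0 < κ.re)
    (f : Lp ℂ 2 (volume : Measure E3)) :
    0 ≤ (κ * inner ℂ f ((isSchurKernel_yukawa hκ).op f)).re := by
  refine (SchwartzMap.denseRange_toLpCLM (E := E3) (F := ℂ) (p := 2) (μ := volume)
    ENNReal.ofNat_ne_top).induction_on (p := fun f =>
      0 ≤ (κ * inner ℂ f ((isSchurKernel_yukawa hκ).op f)).re) f
    (isClosed_le (by fun_prop) (Complex.continuous_re.comp (by fun_prop))) fun f => ?_
  rw [SchwartzMap.toLpCLM_apply, inner_yukawa_op hκ, ← integral_const_mul]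
  have e : ∀ ξ, κ * inner ℂ (𝓕 f ξ) (yukawaSymbol κ ξ * 𝓕 f ξ) =
      ((‖𝓕 f ξ‖ ^ 2 : ℝ) : ℂ) * (κ * yukawaSymbol κ ξ) := fun ξ => by
    rw [← smul_eq_mul (yukawaSymbol κ ξ), inner_smul_right, inner_self_eq_norm_sq_to_K]
    push_cast
    simp only [Complex.coe_algebraMap]
    ring
  simp_rw [e]
  -- Integrability need not be proved: otherwise the integral is zero by convention and the
  -- inequality is trivial.
  by_cases hi : Integrable fun ξ => ((‖𝓕 f ξ‖ ^ 2 : ℝ) : ℂ) * (κ * yukawaSymbol κ ξ)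
  · rw [← RCLike.re_eq_complex_re, ← integral_re hi]
    refine integral_nonneg fun ξ => ?_
    simp only [RCLike.re_eq_complex_re, Complex.re_ofReal_mul]
    exact mul_nonneg (by positivity) (re_mul_yukawaSymbol_nonneg hκ ξ)
  · rw [integral_undef hi, Complex.zero_re]

/-! ### Transfer of the multiplier estimates to `D` -/

/-- Extension by zero of an element of `L²(D)`. -/
noncomputable def extendZero {D : Set E3} (hDm : MeasurableSet D) (f : L2 D) :
    Lp ℂ 2 (volume : Measure E3) :=
  ((memLp_indicator_iff_restrict hDm).2 (Lp.memLp f)).toLp (D.indicator f)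

theorem extendZero_coeFn {D : Set E3} (hDm : MeasurableSet D) (f : L2 D) :
    extendZero hDm f =ᵐ[volume] D.indicator f :=
  MemLp.coeFn_toLp _

theorem norm_extendZero {D : Set E3} (hDm : MeasurableSet D) (f : L2 D) :
    ‖extendZero hDm f‖ = ‖f‖ := by
  rw [extendZero, Lp.norm_toLp, eLpNorm_indicator_eq_eLpNorm_restrict hDm, Lp.norm_def]

section Potential

variable {D : Set E3} (hDo : IsOpen D) (hDb : Bornology.IsBounded D) {c₀ : ℝ} {s : ℂ}

/-- The potential is the compression of the whole-space convolution: extending `f` by zero restricts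
the integration to `D`, and extending `h` by zero discards the values outside `D`. -/
theorem inner_potentialOp (hκ : 0 < (s / c₀).re) (h f : L2 D) :
    inner ℂ h (potentialOp hDo hDb c₀ s f) =
      inner ℂ (extendZero hDo.measurableSet h)
        ((isSchurKernel_yukawa hκ).op (extendZero hDo.measurableSet f)) := by
  have hDm := hDo.measurableSet
  rw [L2.inner_def, L2.inner_def]
  calc _ = ∫ x in D, inner ℂ (h x) (volumePotential D c₀ s f x) := by
        refine integral_congr_ae ?_
        filter_upwards [potentialOp_coeFn hDo hDb c₀ s f] with x hx
        rw [hx]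
    _ = ∫ x, D.indicator (fun x => inner ℂ (h x) (volumePotential D c₀ s f x)) x :=
        (integral_indicator hDm).symm
    _ = _ := by
        refine integral_congr_ae ?_
        filter_upwards [extendZero_coeFn hDm h,
          (isSchurKernel_yukawa hκ).op_coeFn (extendZero hDm f)] with x h1 h2
        rw [h1, h2]
        by_cases hx : x ∈ D
        · rw [Set.indicator_of_mem hx, Set.indicator_of_mem hx, volumePotential,
            ← integral_indicator hDm]
          congr 1
          refine integral_congr_ae ?_
          filter_upwards [extendZero_coeFn hDm f] with y hy
          rw [hy]
          by_cases hyD : y ∈ D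
          · rw [Set.indicator_of_mem hyD, Set.indicator_of_mem hyD, helmholtzKernel_eq_yukawa]
          · rw [Set.indicator_of_notMem hyD, Set.indicator_of_notMem hyD, mul_zero]
        · rw [Set.indicator_of_notMem hx, Set.indicator_of_notMem hx, inner_zero_left]

theorem re_mul_inner_potentialOp_nonneg (hκ : 0 < (s / c₀).re) (f : L2 D) :
    0 ≤ (s / c₀ * inner ℂ f (potentialOp hDo hDb c₀ s f)).re := by
  rw [inner_potentialOp hDo hDb hκ]
  exact re_mul_inner_yukawa_op_nonneg hκ _

theorem norm_potentialOp_le (hκ : 0 < (s / c₀).re) :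
    ‖potentialOp hDo hDb c₀ s‖ ≤ 1 / (‖s / (c₀ : ℂ)‖ * (s / c₀).re) := by
  refine ContinuousLinearMap.opNorm_le_bound _ (by positivity) fun f => ?_
  -- Testing the form bound against `V̂ f` itself gives `‖V̂ f‖²` on the left; one factor is
  -- cancelled below.
  have h := norm_inner_yukawa_op_le hκ
    (extendZero hDo.measurableSet (potentialOp hDo hDb c₀ s f)) (extendZero hDo.measurableSet f)
  rw [← inner_potentialOp hDo hDb hκ, norm_extendZero, norm_extendZero, inner_self_eq_norm_sq_to_K, norm_pow,
    RCLike.norm_ofReal, abs_norm] at h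
  rcases (norm_nonneg (potentialOp hDo hDb c₀ s f)).eq_or_lt with h0 | h0
  · rw [← h0]
    positivity
  · refine le_of_mul_le_mul_left ?_ h0
    linarith

end Potential

/-! ### Dependence of the potential on `s` -/

section Analytic

variable {D : Set E3} (hDo : IsOpen D) (hDb : Bornology.IsBounded D)

theorem potentialOp_eq_op (c₀ : ℝ) (s : ℂ) {C : ℝ}
    (h : IsSchurKernel (volume.restrict D) (helmholtzKernel c₀ s) C) :
    potentialOp hDo hDb c₀ s = h.op := by
  ext1 f
  exact Lp.ext ((potentialOp_coeFn hDo hDb c₀ s f).trans (h.op_coeFn f).symm)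

/-- One factor `|x - y|` cancels the singularity, and every `s`-derivative of the kernel carries
such a factor. -/
theorem exists_norm_sub_mul_helmholtzKernel_le {D : Set E3} (hDb : Bornology.IsBounded D)
    (c₀ : ℝ) (s : ℂ) : ∃ B R : ℝ, 0 ≤ B ∧ 0 ≤ R ∧ ∀ x ∈ D, ∀ y ∈ D, ‖x - y‖ ≤ R ∧
      ‖x - y‖ * ‖helmholtzKernel c₀ s x y‖ ≤ B := by
  obtain ⟨R, hR⟩ := hDb.subset_ball 0
  refine ⟨Real.exp (‖s‖ * (2 * |R|) / |c₀|), 2 * |R|, by positivity, by positivity,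
    fun x hx y hy => ?_⟩
  have hr : ‖x - y‖ ≤ 2 * |R| := by
    have h1 := hR hx
    have h2 := hR hy
    simp only [mem_ball_zero_iff] at h1 h2
    linarith [norm_sub_le x y, le_abs_self R]
  refine ⟨hr, ?_⟩
  have e1 : ‖Complex.exp (-s * (‖x - y‖ : ℂ) / (c₀ : ℂ))‖ ≤
      Real.exp (‖s‖ * (2 * |R|) / |c₀|) := by
    refine (Complex.norm_exp_le_exp_norm _).trans (Real.exp_le_exp.2 ?_)
    rw [norm_div, norm_mul, norm_neg, Complex.norm_real, Complex.norm_real, norm_norm,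
      Real.norm_eq_abs]
    gcongr
  have e2 : ‖(4 * (Real.pi : ℂ) * (‖x - y‖ : ℂ))‖ = 4 * Real.pi * ‖x - y‖ := by
    simp [abs_of_pos Real.pi_pos]
  rw [helmholtzKernel, norm_div, e2]
  rcases (norm_nonneg (x - y)).eq_or_lt with h0 | h0
  · rw [← h0, zero_mul]
    positivity
  · rw [show ∀ a : ℝ, ‖x - y‖ * (a / (4 * Real.pi * ‖x - y‖)) = a / (4 * Real.pi) from
      fun a => by field_simp]
    exact (div_le_self (norm_nonneg _) (by linarith [Real.pi_gt_three])).trans e1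

theorem helmholtzKernel_add (c₀ : ℝ) (s h : ℂ) (x y : E3) :
    helmholtzKernel c₀ (s + h) x y =
      helmholtzKernel c₀ s x y * Complex.exp (-h * (‖x - y‖ : ℂ) / (c₀ : ℂ)) := by
  rw [helmholtzKernel, helmholtzKernel, div_mul_eq_mul_div, ← Complex.exp_add]
  congr 2
  ring

/-- The derivative has the bounded kernel `-(|x - y| / c₀) Φ`. The remainder has kernel `Φ (exp z -
1 - z)` with `z = -(t - s)|x - y| / c₀`, which is `O(|t - s|²)` uniformly on `D × D`; Schur's test
makes this an operator norm bound. -/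
theorem differentiableAt_potentialOp (c₀ : ℝ) (s : ℂ) :
    DifferentiableAt ℂ (potentialOp hDo hDb c₀) s := by
  have hDm := hDo.measurableSet
  obtain ⟨B, R, hB, hR, hBR⟩ := exists_norm_sub_mul_helmholtzKernel_le hDb c₀ s
  have hr : ∀ x ∈ D, ∀ y ∈ D, ‖((‖x - y‖ : ℂ) / c₀)‖ ≤ R / |c₀| := fun x hx y hy => by
    rw [norm_div, Complex.norm_real, Complex.norm_real, norm_norm, Real.norm_eq_abs]
    gcongr
    exact (hBR x hx y hy).1
  have hkr : ∀ x ∈ D, ∀ y ∈ D,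
      ‖((‖x - y‖ : ℂ) / c₀)‖ * ‖helmholtzKernel c₀ s x y‖ ≤ B / |c₀| := fun x hx y hy => by
    rw [norm_div, Complex.norm_real, Complex.norm_real, norm_norm, Real.norm_eq_abs,
      div_mul_eq_mul_div]
    gcongr
    exact (hBR x hx y hy).2
  have hW : IsSchurKernel (volume.restrict D)
      (fun x y => -((‖x - y‖ : ℂ) / c₀) * helmholtzKernel c₀ s x y)
      (B / |c₀| * volume.real D) := by
    refine IsSchurKernel.of_bounded hDm hDb.measure_lt_top.ne ?_ (fun x y => ?_) (by positivity)
      fun x hx y hy => ?_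
    · exact Measurable.mul (by fun_prop) (measurable_helmholtzKernel c₀ s)
    · simp only [norm_sub_rev x y, helmholtzKernel_comm c₀ s x y]
    · rw [norm_mul, norm_neg]
      exact hkr x hx y hy
  set F : ℂ → (L2 D →L[ℂ] L2 D) := fun t =>
    potentialOp hDo hDb c₀ t - potentialOp hDo hDb c₀ s - (t - s) • hW.op with hF
  -- The restriction on `t` ensures `|z| ≤ 1`, where `|exp z - 1 - z| ≤ |z|²`.
  have hbound : ∀ t, ‖t - s‖ * (R / |c₀|) ≤ 1 →
      ‖F t‖ ≤ (B / |c₀|) * (R / |c₀|) * ‖t - s‖ ^ 2 * volume.real D := by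
    intro t ht
    have hK : IsSchurKernel (volume.restrict D)
        (fun x y => helmholtzKernel c₀ t x y - helmholtzKernel c₀ s x y -
          (t - s) * (-((‖x - y‖ : ℂ) / c₀) * helmholtzKernel c₀ s x y))
        ((B / |c₀|) * (R / |c₀|) * ‖t - s‖ ^ 2 * volume.real D) := by
      refine IsSchurKernel.of_bounded hDm hDb.measure_lt_top.ne ?_ (fun x y => ?_) (by positivity)
        fun x hx y hy => ?_
      · exact ((measurable_helmholtzKernel c₀ t).sub (measurable_helmholtzKernel c₀ s)).sub
          (hW.measurable.const_mul _)
      · simp only [norm_sub_rev x y, helmholtzKernel_comm c₀ _ x y]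
      · have e : helmholtzKernel c₀ t x y - helmholtzKernel c₀ s x y -
            (t - s) * (-((‖x - y‖ : ℂ) / c₀) * helmholtzKernel c₀ s x y) =
            helmholtzKernel c₀ s x y * (Complex.exp (-(t - s) * (‖x - y‖ : ℂ) / (c₀ : ℂ)) - 1 -
              (-(t - s) * (‖x - y‖ : ℂ) / (c₀ : ℂ))) := by
          rw [show helmholtzKernel c₀ t x y = helmholtzKernel c₀ (s + (t - s)) x y by simp,
            helmholtzKernel_add]
          ring
        have hz : ‖-(t - s) * (‖x - y‖ : ℂ) / (c₀ : ℂ)‖ =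
            ‖t - s‖ * ‖((‖x - y‖ : ℂ) / c₀)‖ := by
          rw [mul_div_assoc, norm_mul, norm_neg]
        have hz1 : ‖-(t - s) * (‖x - y‖ : ℂ) / (c₀ : ℂ)‖ ≤ 1 := by
          rw [hz]
          exact le_trans (by gcongr; exact hr x hx y hy) ht
        rw [e, norm_mul]
        calc _ ≤ ‖helmholtzKernel c₀ s x y‖ * ‖-(t - s) * (‖x - y‖ : ℂ) / (c₀ : ℂ)‖ ^ 2 := by
              gcongr
              exact Complex.norm_exp_sub_one_sub_id_le hz1
          _ = (‖((‖x - y‖ : ℂ) / c₀)‖ * ‖helmholtzKernel c₀ s x y‖) *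
              ‖((‖x - y‖ : ℂ) / c₀)‖ * ‖t - s‖ ^ 2 := by
              rw [hz]
              ring
          _ ≤ _ := by
              gcongr
              · exact hkr x hx y hy
              · exact hr x hx y hy
    have hFK : F t = hK.op := by
      obtain ⟨Ct, hCt⟩ := exists_isSchurKernel_helmholtz hDm hDb c₀ t
      obtain ⟨Cs, hCs⟩ := exists_isSchurKernel_helmholtz hDm hDb c₀ s
      ext1 f
      refine Lp.ext ?_
      rw [hF]
      dsimp only
      rw [potentialOp_eq_op hDo hDb c₀ t hCt, potentialOp_eq_op hDo hDb c₀ s hCs]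
      simp only [sub_apply, smul_apply]
      filter_upwards [Lp.coeFn_sub (hCt.op f - hCs.op f) ((t - s) • hW.op f),
        Lp.coeFn_sub (hCt.op f) (hCs.op f), Lp.coeFn_smul (t - s) (hW.op f),
        hCt.op_coeFn f, hCs.op_coeFn f, hW.op_coeFn f, hK.op_coeFn f,
        hCt.ae_integrable f, hCs.ae_integrable f, hW.ae_integrable f]
        with x a1 a2 a3 a4 a5 a6 a7 i1 i2 i3
      rw [a1, Pi.sub_apply, a2, Pi.sub_apply, a3, Pi.smul_apply, a4, a5, a6, a7, smul_eq_mul,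
        ← integral_const_mul, ← integral_sub i1 i2]
      refine (integral_sub (i1.sub i2) (i3.const_mul _)).symm.trans ?_
      refine integral_congr_ae (.of_forall fun y => ?_)
      simp only [Pi.sub_apply]
      ring
    rw [hFK]
    exact hK.norm_op_le
  have hO : F =O[nhds s] fun t => ‖t - s‖ ^ 2 := by
    refine Asymptotics.IsBigO.of_bound ((B / |c₀|) * (R / |c₀|) * volume.real D) ?_
    have hc : Tendsto (fun t : ℂ => ‖t - s‖ * (R / |c₀|)) (nhds s) (nhds 0) := by
      have : Continuous fun t : ℂ => ‖t - s‖ * (R / |c₀|) := by fun_prop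
      simpa using this.tendsto s
    filter_upwards [hc.eventually_le_const one_pos] with t ht
    rw [norm_pow, norm_norm]
    exact (hbound t ht).trans_eq (by ring)
  have hFd : DifferentiableAt ℂ F s := (hO.hasFDerivAt one_lt_two).differentiableAt
  have : potentialOp hDo hDb c₀ = fun t => F t + (potentialOp hDo hDb c₀ s + (t - s) • hW.op) := by
    funext t
    rw [hF]
    dsimp only
    abel
  rw [this]
  fun_prop

end Analytic

/-! ### The weighted space, its embedding and multiplication by `q` -/

theorem IsContrast.integral_weightedMeasure {D : Set E3} {q : E3 → ℝ} (hq : IsContrast D q)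
    (h : E3 → ℂ) :
    ∫ x, h x ∂weightedMeasure D q = ∫ x in D, (q x : ℂ) * h x := by
  rw [weightedMeasure, integral_withDensity_eq_integral_toReal_smul₀ hq.aemeasurable
    (.of_forall fun _ => ENNReal.ofReal_lt_top)]
  refine integral_congr_ae ?_
  filter_upwards [hq.nonneg] with x hx
  rw [ENNReal.toReal_ofReal hx, Complex.real_smul]

theorem IsContrast.integrable_mul {D : Set E3} {q : E3 → ℝ} (hq : IsContrast D q) {h : E3 → ℝ}
    (hi : Integrable h (weightedMeasure D q)) :
    Integrable (fun x => q x * h x) (volume.restrict D) := by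
  rw [weightedMeasure, integrable_withDensity_iff_integrable_smul₀'
    hq.aemeasurable (.of_forall fun _ => ENNReal.ofReal_lt_top)] at hi
  refine hi.congr ?_
  filter_upwards [hq.nonneg] with x hx
  rw [ENNReal.toReal_ofReal hx, smul_eq_mul]

section Weighted

variable {D : Set E3} {q : E3 → ℝ} (hq : IsContrast D q)

/-- The embedding `L²(D) → L²_q(D)` is adjoint to multiplication by `q`. -/
theorem inner_weightedEmbedding (g : L2w D q) (u : L2 D) :
    inner ℂ g (weightedEmbedding hq u) = inner ℂ (mulWeight hq g) u := by
  rw [L2.inner_def, L2.inner_def]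
  calc _ = ∫ x, inner ℂ (g x) (u x) ∂weightedMeasure D q := by
        refine integral_congr_ae ?_
        filter_upwards [weightedEmbedding_coeFn hq u] with x hx
        rw [hx]
    _ = ∫ x in D, inner ℂ (mulWeight hq g x) (u x) := by
        rw [hq.integral_weightedMeasure]
        refine integral_congr_ae ?_
        filter_upwards [mulWeight_coeFn hq g] with x hx
        rw [hx, ← smul_eq_mul (q x : ℂ) (g x), inner_smul_left, Complex.conj_ofReal]

/-- Pointwise `q² ≤ qPlus · q`: one factor of `q` is estimated, the other is the weight. -/
theorem norm_mulWeight_le {qPlus : ℝ} (hqPlus : 0 ≤ qPlus)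
    (hq_le : ∀ᵐ x ∂volume.restrict D, q x ≤ qPlus) : ‖mulWeight hq‖ ≤ √qPlus := by
  refine ContinuousLinearMap.opNorm_le_bound _ (Real.sqrt_nonneg _) fun g => ?_
  have h : ‖mulWeight hq g‖ ^ 2 ≤ (√qPlus * ‖g‖) ^ 2 := by
    have e : ‖mulWeight hq g‖ ^ 2 = ∫ x in D, q x ^ 2 * ‖g x‖ ^ 2 := by
      have h := L2.inner_def (𝕜 := ℂ) (mulWeight hq g) (mulWeight hq g)
      simp only [inner_self_eq_norm_sq_to_K] at h
      rw [← Complex.ofReal_inj, ← integral_complex_ofReal]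
      refine Eq.trans (by simp) (h.trans (integral_congr_ae ?_))
      filter_upwards [mulWeight_coeFn hq g] with x hx
      rw [hx, norm_mul, Complex.norm_real, ← sq_abs (q x), ← mul_pow, Real.norm_eq_abs]
      exact (Complex.ofReal_pow _ _).symm
    have hi : Integrable (fun x => q x * ‖g x‖ ^ 2) (volume.restrict D) :=
      hq.integrable_mul ((Lp.memLp g).integrable_norm_pow two_ne_zero)
    rw [mul_pow, Real.sq_sqrt hqPlus, norm_sq_L2w hq, e, ← integral_const_mul]
    refine integral_mono_of_nonneg (.of_forall fun x => by positivity) (hi.const_mul _) ?_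
    filter_upwards [hq.nonneg, hq_le] with x h0 h1
    rw [pow_two, mul_assoc]
    gcongr
  exact le_of_sq_le_sq h (by positivity)

/-- The bound passes from multiplication by `q` to its adjoint, by pairing the image of `u` with
itself. -/
theorem norm_weightedEmbedding_le {qPlus : ℝ} (hqPlus : 0 ≤ qPlus)
    (hq_le : ∀ᵐ x ∂volume.restrict D, q x ≤ qPlus) : ‖weightedEmbedding hq‖ ≤ √qPlus := by
  refine ContinuousLinearMap.opNorm_le_bound _ (Real.sqrt_nonneg _) fun u => ?_
  rcases (norm_nonneg (weightedEmbedding hq u)).eq_or_lt with h0 | h0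
  · rw [← h0]
    positivity
  · refine le_of_mul_le_mul_left ?_ h0
    calc ‖weightedEmbedding hq u‖ * ‖weightedEmbedding hq u‖
        = ‖inner ℂ (weightedEmbedding hq u) (weightedEmbedding hq u)‖ := by
          rw [inner_self_eq_norm_sq_to_K, norm_pow, RCLike.norm_ofReal, abs_norm, pow_two]
      _ = ‖inner ℂ (mulWeight hq (weightedEmbedding hq u)) u‖ := by
          rw [inner_weightedEmbedding]
      _ ≤ ‖mulWeight hq (weightedEmbedding hq u)‖ * ‖u‖ := norm_inner_le_norm _ _
      _ ≤ (√qPlus * ‖weightedEmbedding hq u‖) * ‖u‖ := by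
          gcongr
          exact (mulWeight hq).le_of_opNorm_le (norm_mulWeight_le hq hqPlus hq_le) _
      _ = ‖weightedEmbedding hq u‖ * (√qPlus * ‖u‖) := by ring

/-! ### Norm, coercivity and inversion in the weighted space -/

variable (hDo : IsOpen D) (hDb : Bornology.IsBounded D) {c₀ : ℝ} {s : ℂ}

/-- The embedding and the multiplication each contribute `√qPlus`, and the powers of `c₀` cancel
between `s² / c₀²` and the bound `c₀² / (|s| σ)` on the potential. -/
theorem norm_scaledPotential_le (hc₀ : 0 < c₀) (hs : 0 < s.re) {qPlus : ℝ}
    (hqPlus : 0 ≤ qPlus) (hq_le : ∀ᵐ x ∂volume.restrict D, q x ≤ qPlus) :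
    ‖scaledPotential hDo hDb hq c₀ s‖ ≤ qPlus * ‖s‖ / s.re := by
  have hκ : (s / c₀).re = s.re / c₀ := Complex.div_ofReal_re s c₀
  have hn : 0 < ‖s‖ := norm_pos_iff.2 fun h => by simp [h] at hs
  have hV := norm_potentialOp_le hDo hDb (c₀ := c₀) (s := s) (by rw [hκ]; positivity)
  rw [hκ, norm_div, Complex.norm_real, Real.norm_of_nonneg hc₀.le] at hV
  rw [scaledPotential, weightedPotential, norm_smul, norm_div, norm_pow, norm_pow,
    Complex.norm_real, Real.norm_of_nonneg hc₀.le]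
  calc _ ≤ ‖s‖ ^ 2 / c₀ ^ 2 * (√qPlus * (1 / (‖s‖ / c₀ * (s.re / c₀)) * √qPlus)) := by
        gcongr
        refine (ContinuousLinearMap.opNorm_comp_le _ _).trans ?_
        gcongr
        · exact norm_weightedEmbedding_le hq hqPlus hq_le
        refine (ContinuousLinearMap.opNorm_comp_le _ _).trans ?_
        gcongr
        exact norm_mulWeight_le hq hqPlus hq_le
    _ = ‖s‖ ^ 2 / c₀ ^ 2 * (√qPlus * √qPlus * (1 / (‖s‖ / c₀ * (s.re / c₀)))) := by ring
    _ = _ := by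
        rw [Real.mul_self_sqrt hqPlus]
        field_simp

theorem le_norm_inner_one_add_scaledPotential (hc₀ : 0 < c₀) (hs : 0 < s.re) (g : L2w D q) :
    ‖g‖ ^ 2 * (s.re / ‖s‖) ≤ ‖inner ℂ g ((1 + scaledPotential hDo hDb hq c₀ s) g)‖ := by
  have hκ : (s / c₀).re = s.re / c₀ := Complex.div_ofReal_re s c₀
  have hs0 : s ≠ 0 := fun h => by simp [h] at hs
  have hc : (c₀ : ℂ) ≠ 0 := by exact_mod_cast hc₀.ne'
  have hn : 0 < ‖s‖ := norm_pos_iff.2 hs0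
  have hpos := re_mul_inner_potentialOp_nonneg hDo hDb (c₀ := c₀) (s := s)
    (by rw [hκ]; positivity) (mulWeight hq g)
  set w := inner ℂ (mulWeight hq g) (potentialOp hDo hDb c₀ s (mulWeight hq g)) with hw
  have e : inner ℂ g ((1 + scaledPotential hDo hDb hq c₀ s) g) =
      ((‖g‖ ^ 2 : ℝ) : ℂ) + s ^ 2 / (c₀ : ℂ) ^ 2 * w := by
    rw [add_apply, one_apply_eq_self, inner_add_right,
      inner_self_eq_norm_sq_to_K, scaledPotential, smul_apply,
      inner_smul_right, ContinuousLinearMap.comp_apply, inner_weightedEmbedding, weightedPotential,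
      ContinuousLinearMap.comp_apply]
    simp [hw]
  have hre : ‖g‖ ^ 2 * (s.re / ‖s‖ ^ 2) ≤
      (s⁻¹ * inner ℂ g ((1 + scaledPotential hDo hDb hq c₀ s) g)).re := by
    -- Division by `s` brings the potential term to `κ ⟨q g, V̂ (q g)⟩ / c₀`, whose real part is
    -- nonnegative, while `Re s⁻¹ = σ / |s|²`.
    have e2 : s⁻¹ * (((‖g‖ ^ 2 : ℝ) : ℂ) + s ^ 2 / (c₀ : ℂ) ^ 2 * w) =
        ((‖g‖ ^ 2 : ℝ) : ℂ) * s⁻¹ + ((c₀⁻¹ : ℝ) : ℂ) * (s / c₀ * w) := by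
      push_cast
      field_simp
    rw [e, e2, Complex.add_re, Complex.re_ofReal_mul, Complex.re_ofReal_mul, Complex.inv_re,
      ← Complex.sq_norm]
    linarith [mul_nonneg (inv_nonneg.2 hc₀.le) hpos]
  have h := hre.trans (Complex.re_le_norm _)
  rw [norm_mul, norm_inv, inv_mul_eq_div, le_div_iff₀ hn] at h
  refine le_trans (le_of_eq ?_) h
  field_simp

/-- A Lax–Milgram argument: the coercivity constant is `σ / |s|`. -/
theorem isUnit_one_add_scaledPotential (hc₀ : 0 < c₀) (hs : 0 < s.re) :
    IsUnit (1 + scaledPotential hDo hDb hq c₀ s) := by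
  have hn : 0 < ‖s‖ := norm_pos_iff.2 fun h => by simp [h] at hs
  refine ContinuousLinearMap.isUnit_of_forall_le_norm_inner_map _
    (c := ⟨s.re / ‖s‖, by positivity⟩) (NNReal.coe_pos.1 (div_pos hs hn))
    fun g => ?_
  rw [norm_inner_symm]
  exact le_norm_inner_one_add_scaledPotential hq hDo hDb hc₀ hs g

theorem norm_inverse_one_add_scaledPotential_le (hc₀ : 0 < c₀) (hs : 0 < s.re) :
    ‖(1 + scaledPotential hDo hDb hq c₀ s)⁻¹ʳ‖ ≤ ‖s‖ / s.re := by
  have hn : 0 < ‖s‖ := norm_pos_iff.2 fun h => by simp [h] at hs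
  refine ContinuousLinearMap.opNorm_le_bound _ (by positivity) fun g => ?_
  set T := 1 + scaledPotential hDo hDb hq c₀ s with hT
  have hTg : T (T⁻¹ʳ g) = g := by
    rw [← mul_apply_eq_comp,
      Ring.mul_inverse_cancel _ (isUnit_one_add_scaledPotential hq hDo hDb hc₀ hs),
      one_apply_eq_self]
  -- Coercivity at `T⁻¹ g` with Cauchy–Schwarz gives `‖T⁻¹ g‖² σ / |s| ≤ ‖T⁻¹ g‖ ‖g‖`.
  have h := (le_norm_inner_one_add_scaledPotential hq hDo hDb hc₀ hs (T⁻¹ʳ g)).trans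
    (norm_inner_le_norm _ _)
  rw [← hT, hTg] at h
  rcases (norm_nonneg (T⁻¹ʳ g)).eq_or_lt with h0 | h0
  · rw [← h0]
    positivity
  · rw [pow_two, mul_assoc] at h
    have h1 := le_of_mul_le_mul_left h h0
    rw [mul_div_assoc', div_le_iff₀ hn] at h1
    rw [div_mul_eq_mul_div, le_div_iff₀ hs]
    linarith

/-- No half plane is needed here: on a bounded `D` the exponential stays bounded for every `s`. -/
theorem analyticOnNhd_scaledPotential (c₀ : ℝ) :
    AnalyticOnNhd ℂ (scaledPotential hDo hDb hq c₀) Set.univ := by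
  refine DifferentiableOn.analyticOnNhd (fun s _ => ?_) isOpen_univ
  have h := differentiableAt_potentialOp hDo hDb c₀ s
  unfold scaledPotential weightedPotential
  refine DifferentiableAt.differentiableWithinAt ?_
  fun_prop

theorem analyticOnNhd_inverse_one_add_scaledPotential (hc₀ : 0 < c₀) :
    AnalyticOnNhd ℂ (fun s : ℂ => (1 + scaledPotential hDo hDb hq c₀ s)⁻¹ʳ)
      {s : ℂ | 0 < s.re} := fun s hs => by
  obtain ⟨u, hu⟩ := isUnit_one_add_scaledPotential hq hDo hDb hc₀ hs
  have h := analyticAt_inverse (𝕜 := ℂ) u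
  rw [hu] at h
  exact h.comp (f := fun s => 1 + scaledPotential hDo hDb hq c₀ s)
    (analyticAt_const.add (analyticOnNhd_scaledPotential hq hDo hDb c₀ s trivial))

end Weighted

theorem mainTheorem2 (c₀ : ℝ) (hc₀ : 0 < c₀) (D : Set E3) (hDo : IsOpen D)
    (hDb : Bornology.IsBounded D) (q : E3 → ℝ) (hq : IsContrast D q) (qPlus : ℝ)
    (hqPlus : 0 ≤ qPlus) (hq_le : ∀ᵐ x ∂volume.restrict D, q x ≤ qPlus) :
    (∀ s : ℂ, 0 < s.re →
      IsUnit (1 + scaledPotential hDo hDb hq c₀ s) ∧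
      ‖(1 + scaledPotential hDo hDb hq c₀ s)⁻¹ʳ * scaledPotential hDo hDb hq c₀ s‖ ≤
        qPlus / s.re ^ 2 * ‖s‖ ^ 2 ∧
      ‖(1 + scaledPotential hDo hDb hq c₀ s)⁻¹ʳ‖ ≤ ‖s‖ / s.re) ∧
    AnalyticOnNhd ℂ
      (fun s : ℂ => (1 + scaledPotential hDo hDb hq c₀ s)⁻¹ʳ * scaledPotential hDo hDb hq c₀ s)
      {s : ℂ | 0 < s.re} ∧
    AnalyticOnNhd ℂ (fun s : ℂ => (1 + scaledPotential hDo hDb hq c₀ s)⁻¹ʳ)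
      {s : ℂ | 0 < s.re} := by
  have hB := analyticOnNhd_inverse_one_add_scaledPotential hq hDo hDb hc₀
  refine ⟨fun s hs => ⟨isUnit_one_add_scaledPotential hq hDo hDb hc₀ hs, ?_,
    norm_inverse_one_add_scaledPotential_le hq hDo hDb hc₀ hs⟩,
    hB.mul ((analyticOnNhd_scaledPotential hq hDo hDb c₀).mono (Set.subset_univ _)), hB⟩
  calc _ ≤ ‖s‖ / s.re * (qPlus * ‖s‖ / s.re) := by
        refine (norm_mul_le _ _).trans ?_
        gcongr
        · exact norm_inverse_one_add_scaledPotential_le hq hDo hDb hc₀ hs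
        · exact norm_scaledPotential_le hq hDo hDb hc₀ hs hqPlus hq_le
    _ = qPlus / s.re ^ 2 * ‖s‖ ^ 2 := by ring
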